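/- A Hopf–von Neumann algebra is a pair $(\mathfrak M,\Gamma)$ of a von Neumann algebra $\mathfrak M$ and a normal unital $*$-homomorphism $\Gamma:\mathfrak M\to\mathfrak M\,\bar\otimes\,\mathfrak M$ with $(\iota\otimes\Gamma)\Gamma=(\Gamma\otimes\iota)\Gamma$; its predual $\mathfrak M_*$ is a Banach algebra under $(\omega*\omega')(x)=(\omega\otimes\omega')(\Gamma(x))$. A left action of $(\mathfrak M,\Gamma)$ on a von Neumann algebra $\mathfrak N$ is a normal injective (not necessarily unital) $*$-homomorphism $\alpha:\mathfrak N\to\mathfrak M\,\bar\otimes\,\mathfrak N$ with $(\iota\otimes\alpha)\alpha=(\Gamma\otimes\iota)\alpha$. For $\omega\in\mathfrak M_*$ and $\nu\in\mathfrak N_*$ let $\alpha_*(\omega\otimes\nu)=(\omega\otimes\nu)\circ\alpha\in\mathfrak N_*$, and let $${\rm LUC}(\mathfrak N,\alpha)=\overline{\rm span}\{(\omega\otimes\iota)\alpha(y):\ y\in\mathfrak N,\ \omega\in\mathfrak M_*\}\subseteq\mathfrak N$$ (norm closure). A left invariant mean on ${\rm LUC}(\mathfrak N,\alpha)$ is a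 positive linear functional $M_0$ of norm one on this space (equivalently, when $\alpha$ is unital, a positive functional with $M_0(1)=1$) such that $M_0((\omega\otimes\iota)\alpha(y))=\omega(1)M_0(y)$ for all $\omega\in\mathfrak M_*$, $y\in{\rm LUC}(\mathfrak N,\alpha)$. Let $\alpha$ be a left action of a Hopf–von Neumann algebra $(\mathfrak M,\Gamma)$ on a von Neumann algebra $\mathfrak N$. Consider the following assertions: (i) $(\mathfrak N,\alpha)$ has Reiter's property $FP_1$: for every $\epsilon>0$ and every finite set $\{\omega_1,\dots,\omega_n\}\subset\mathfrak M_*$ there is a state $\nu\in\mathfrak N_*$ with $\|\alpha_*(\omega_k\otimes\nu)-\omega_k(1)\nu\|<\epsilon$ for $k=1,\dots,n$. (ii) $(\mathfrak N,\alpha)$ is left amenable: there is a state $N$ of $\mathfrak N$ with $N((\omega\otimes\iota)\alpha(y))=\omega(1)N(y)$ for all $\omega\in\mathfrak M_*$, $y\in\mathfrak N$. (iii) There is a left invariant mean on ${\rm LUC}(\mathfrak N,\alpha)$. Then (i) $\Leftrightarrow$ (ii) $\Rightarrow$ (iii), and all three assertions are equivalent whenever $\mathfrak M_*$ has a (two-sided)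 bounded approximate identity consisting of states. -/

import Mathlib

set_option linter.unusedSectionVars false

noncomputable section

open scoped TensorProduct InnerProductSpace InnerProduct ComplexOrder ComplexConjugate

universe u v w

variable {H : Type u} [NormedAddCommGroup H] [InnerProductSpace ℂ H]
variable {K : Type v} [NormedAddCommGroup K] [InnerProductSpace ℂ K]
variable {L : Type w} [NormedAddCommGroup L] [InnerProductSpace ℂ L]

/-- The Hilbert space tensor product `H ⊗ K`. -/
def HTensor (H : Type u) (K : Type v) [NormedAddCommGroup H] [InnerProductSpace ℂ H]
    [NormedAddCommGroup K] [InnerProductSpace ℂ K] : Type (max u v) :=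
  UniformSpace.Completion (H ⊗[ℂ] K)

namespace HTensor

instance : NormedAddCommGroup (HTensor H K) :=
  inferInstanceAs (NormedAddCommGroup (UniformSpace.Completion (H ⊗[ℂ] K)))
instance : InnerProductSpace ℂ (HTensor H K) :=
  inferInstanceAs (InnerProductSpace ℂ (UniformSpace.Completion (H ⊗[ℂ] K)))
instance : CompleteSpace (HTensor H K) :=
  inferInstanceAs (CompleteSpace (UniformSpace.Completion (H ⊗[ℂ] K)))

/-- The canonical isometric embedding of the algebraic tensor product. -/
def of (H : Type u) (K : Type v) [NormedAddCommGroup H] [InnerProductSpace ℂ H]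
    [NormedAddCommGroup K] [InnerProductSpace ℂ K] : H ⊗[ℂ] K →ₗᵢ[ℂ] HTensor H K :=
  UniformSpace.Completion.toComplₗᵢ

theorem denseRange_of : DenseRange (of H K) := UniformSpace.Completion.denseRange_coe

/-- The continuous extension to `H ⊗ K` of a bounded (semi)linear map on the algebraic tensor
product. -/
def extend {σ : ℂ →+* ℂ} [RingHomIsometric σ] {E : Type*} [NormedAddCommGroup E] [NormedSpace ℂ E]
    [CompleteSpace E] (f : H ⊗[ℂ] K →SL[σ] E) : HTensor H K →SL[σ] E :=
  ContinuousLinearMap.extend f (of H K).toContinuousLinearMap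

theorem extend_of {σ : ℂ →+* ℂ} [RingHomIsometric σ] {E : Type*} [NormedAddCommGroup E]
    [NormedSpace ℂ E] [CompleteSpace E] (f : H ⊗[ℂ] K →SL[σ] E) (x : H ⊗[ℂ] K) :
    extend f (of H K x) = f x :=
  ContinuousLinearMap.extend_eq (e := (of H K).toContinuousLinearMap) f denseRange_of
    (of H K).isometry.isUniformInducing x

/-- The elementary tensor `h ⊗ k`. -/
def tmul (h : H) (k : K) : HTensor H K := of H K (h ⊗ₜ[ℂ] k)

theorem inner_tmul (h h' : H) (k k' : K) :
    ⟪tmul h k, tmul h' k'⟫_ℂ = ⟪h, h'⟫_ℂ * ⟪k, k'⟫_ℂ := by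
  simp [tmul]

/-- The operator `k ↦ h ⊗ k`. -/
def creL (K : Type v) [NormedAddCommGroup K] [InnerProductSpace ℂ K] (h : H) :
    K →L[ℂ] HTensor H K :=
  (of H K).toContinuousLinearMap ∘L TensorProduct.mkL ℂ H K h

/-- The operator `h ↦ h ⊗ k`. -/
def creR (H : Type u) [NormedAddCommGroup H] [InnerProductSpace ℂ H] (k : K) :
    H →L[ℂ] HTensor H K :=
  (of H K).toContinuousLinearMap ∘L (TensorProduct.mkL ℂ H K).flip k

@[simp] theorem creL_apply (h : H) (k : K) : creL K h k = tmul h k := rfl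
@[simp] theorem creR_apply (h : H) (k : K) : creR H k h = tmul h k := rfl

/-- The bounded operator `x ⊗ y` on `H ⊗ K`. -/
def mapOp (x : H →L[ℂ] H) (y : K →L[ℂ] K) : HTensor H K →L[ℂ] HTensor H K :=
  extend ((of H K).toContinuousLinearMap ∘L TensorProduct.mapL x y)

@[simp] theorem mapOp_tmul (x : H →L[ℂ] H) (y : K →L[ℂ] K) (h : H) (k : K) :
    mapOp x y (tmul h k) = tmul (x h) (y k) := by
  rw [mapOp, tmul, extend_of]
  rfl

theorem creL_add (h h' : H) : creL K (h + h') = creL K h + creL K h' := by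
  ext k; simp [creL]
theorem creL_smul (c : ℂ) (h : H) : creL K (c • h) = c • creL K h := by
  ext k; simp [creL]
theorem creR_add (k k' : K) : creR H (k + k') = creR H k + creR H k' := by
  ext k; simp [creR]
theorem creR_smul (c : ℂ) (k : K) : creR H (c • k) = c • creR H k := by
  ext k; simp [creR]
theorem norm_creR_le (k : K) : ‖creR H k‖ ≤ ‖k‖ :=
  ContinuousLinearMap.opNorm_le_bound _ (norm_nonneg _) fun h => by
    simp [creR, mul_comm]

/-- Two bounded operators that agree on elementary tensors are equal. -/
theorem ext_tmul {E : Type*} [NormedAddCommGroup E] [NormedSpace ℂ E]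
    {f g : HTensor H K →L[ℂ] E} (hfg : ∀ h k, f (tmul h k) = g (tmul h k)) : f = g := by
  ext x
  induction x using denseRange_of.induction_on with
  | hp => exact isClosed_eq f.continuous g.continuous
  | ih a =>
    induction a with
    | zero => rw [map_zero, map_zero, map_zero]
    | tmul h k => exact hfg h k
    | add a b ha hb => simp only [map_add, ha, hb]

/-- Vectors are separated by elementary tensors. -/
theorem ext_inner {a b : HTensor H K} (hab : ∀ h k, ⟪tmul h k, a⟫_ℂ = ⟪tmul h k, b⟫_ℂ) :
    a = b := by
  have : innerSL ℂ a = innerSL ℂ b := ext_tmul fun h k => by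
    rw [innerSL_apply_apply, innerSL_apply_apply, ← inner_conj_symm, hab h k, inner_conj_symm]
  refine ext_inner_right ℂ fun v => ?_
  exact DFunLike.congr_fun this v

end HTensor

open HTensor

section Block
variable {n : ℕ}

/-- A matrix of operators on `L` as an operator on `L ⊕ ⋯ ⊕ L`. -/
def blockOp (w : CStarMatrix (Fin n) (Fin n) (L →L[ℂ] L)) :
    PiLp 2 (fun _ : Fin n => L) →L[ℂ] PiLp 2 (fun _ : Fin n => L) :=
  (PiLp.continuousLinearEquiv 2 ℂ (fun _ : Fin n => L)).symm.toContinuousLinearMap ∘L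
    (ContinuousLinearMap.pi fun j => ∑ i, w j i ∘L ContinuousLinearMap.proj i) ∘L
      (PiLp.continuousLinearEquiv 2 ℂ (fun _ : Fin n => L)).toContinuousLinearMap

theorem blockOp_apply (w : CStarMatrix (Fin n) (Fin n) (L →L[ℂ] L))
    (l : PiLp 2 (fun _ : Fin n => L)) (j : Fin n) : blockOp w l j = ∑ i, w j i (l i) := by
  simp [blockOp]

variable [CompleteSpace L]

/-- `blockOp` as a `*`-homomorphism. -/
def blockHom (n : ℕ) : CStarMatrix (Fin n) (Fin n) (L →L[ℂ] L) →⋆ₙₐ[ℂ]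
    (PiLp 2 (fun _ : Fin n => L) →L[ℂ] PiLp 2 (fun _ : Fin n => L)) where
  toFun := blockOp
  map_smul' c w := by
    ext l j; simp [blockOp_apply, Finset.smul_sum]
  map_zero' := by ext l j; simp [blockOp_apply]
  map_add' a b := by ext l j; simp [blockOp_apply, Finset.sum_add_distrib]
  map_mul' a b := by
    ext l j
    simp only [blockOp_apply, mul_apply_eq_comp, CStarMatrix.mul_apply,
      FunLike.coe_sum, Finset.sum_apply, map_sum]
    rw [Finset.sum_comm]
  map_star' a := by
    rw [ContinuousLinearMap.star_eq_adjoint, ContinuousLinearMap.eq_adjoint_iff]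
    intro x y
    simp only [PiLp.inner_apply, blockOp_apply, CStarMatrix.star_apply, sum_inner, inner_sum,
      ContinuousLinearMap.star_eq_adjoint, ContinuousLinearMap.adjoint_inner_left]
    rw [Finset.sum_comm]

theorem blockHom_injective (n : ℕ) : Function.Injective (blockHom (L := L) n) := by
  intro a b hab
  ext j i l
  have := congrArg (fun f => f (WithLp.toLp 2 (Pi.single i l)) j) hab
  simpa [blockHom, blockOp_apply, Pi.single_apply, apply_ite] using this

end Block

section Sesq

/-- A sesquilinear operator-valued kernel on `H` with uniformly bounded orthonormal blocks is the
kernel of a bounded operator on the tensor product. -/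
theorem exists_op_of_kernel (S : H →ₗ⋆[ℂ] H →ₗ[ℂ] (L →L[ℂ] L)) (C : ℝ)
    (hC : ∀ (n : ℕ) (e : Fin n → H), Orthonormal ℂ e → ∀ l l' : PiLp 2 (fun _ : Fin n => L),
      ‖∑ j, ∑ i, ⟪l' j, S (e j) (e i) (l i)⟫_ℂ‖ ≤ C * ‖l‖ * ‖l'‖) :
    ∃ w : HTensor H L →L[ℂ] HTensor H L, ∀ h' h l' l,
      ⟪tmul h' l', w (tmul h l)⟫_ℂ = ⟪l', S h' h l⟫_ℂ := by
  let G : H ⊗[ℂ] L →ₗ⋆[ℂ] H ⊗[ℂ] L →ₗ[ℂ] ℂ :=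
    TensorProduct.lift (LinearMap.mk₂'ₛₗ (starRingEnd ℂ) (starRingEnd ℂ)
      (fun h l => TensorProduct.lift (LinearMap.mk₂'ₛₗ (RingHom.id ℂ) (RingHom.id ℂ)
        (fun h' l' => ⟪S h' h l, l'⟫_ℂ)
        (by intros; simp) (by intros; simp [mul_comm]) (by intros; simp) (by intros; simp)))
      (by intros; ext; simp) (by intros; ext; simp [mul_comm])
      (by intros; ext; simp) (by intros; ext; simp [mul_comm]))
  have hG (h l h' l') : G (h ⊗ₜ l) (h' ⊗ₜ l') = ⟪S h' h l, l'⟫_ℂ := rfl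
  have hbound (x y) : ‖G x y‖ ≤ C * ‖x‖ * ‖y‖ := by
    obtain ⟨E, hE, hsub⟩ := TensorProduct.exists_finite_submodule_left_of_setFinite
      ({x, y} : Set (H ⊗[ℂ] L)) (by simp)
    let b := stdOrthonormalBasis ℂ E
    have hon : Orthonormal ℂ (fun i => (b i : H)) := by
      exact b.orthonormal.comp_linearIsometry E.subtypeₗᵢ
    have key (x) (hx : x ∈ (LinearMap.rTensor L E.subtype).range) :
        ∃ l : PiLp 2 (fun _ : Fin (Module.finrank ℂ E) => L),
          x = ∑ i, (b i : H) ⊗ₜ[ℂ] l i ∧ ‖x‖ = ‖l‖ := by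
      obtain ⟨t, rfl⟩ := hx
      have h1 : ∃ l : PiLp 2 (fun _ : Fin (Module.finrank ℂ E) => L),
          LinearMap.rTensor L E.subtype t = ∑ i, (b i : H) ⊗ₜ[ℂ] l i := by
        induction t with
        | zero => exact ⟨0, by simp⟩
        | tmul h l =>
          refine ⟨WithLp.toLp 2 fun i => ⟪b i, h⟫_ℂ • l, ?_⟩
          simp only [LinearMap.rTensor_tmul, Submodule.subtype_apply]
          conv_lhs => rw [← b.sum_repr' h]
          simp [TensorProduct.sum_tmul, TensorProduct.smul_tmul]
        | add a c ha hc =>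
          obtain ⟨l, hl⟩ := ha
          obtain ⟨m, hm⟩ := hc
          exact ⟨l + m, by simp [hl, hm, TensorProduct.tmul_add, Finset.sum_add_distrib]⟩
      obtain ⟨l, hl⟩ := h1
      refine ⟨l, hl, ?_⟩
      have : ⟪LinearMap.rTensor L E.subtype t, LinearMap.rTensor L E.subtype t⟫_ℂ = ⟪l, l⟫_ℂ := by
        rw [hl]
        simp only [PiLp.inner_apply]
        simp [sum_inner, inner_sum, orthonormal_iff_ite.1 hon]
      rw [@norm_eq_sqrt_re_inner ℂ, this, ← @norm_eq_sqrt_re_inner ℂ]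
    obtain ⟨l, hl, hln⟩ := key x (hsub (by simp))
    obtain ⟨l', hl', hln'⟩ := key y (hsub (by simp))
    rw [hln, hln']
    refine le_trans (le_of_eq ?_) (hC _ _ hon l l')
    rw [hl, hl', ← RCLike.norm_conj]
    simp only [map_sum, LinearMap.sum_apply, hG, inner_conj_symm]
  let G0 : H ⊗[ℂ] L →L⋆[ℂ] H ⊗[ℂ] L →L[ℂ] ℂ := G.mkContinuous₂ C hbound
  let G1 : HTensor H L →L⋆[ℂ] HTensor H L →L[ℂ] ℂ := 
    HTensor.extend (HTensor.extend G0.flip).flip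
  refine ⟨InnerProductSpace.continuousLinearMapOfBilin G1, fun h' h l' l => ?_⟩
  have h1 : ⟪InnerProductSpace.continuousLinearMapOfBilin G1 (tmul h l), tmul h' l'⟫_ℂ =
      ⟪S h' h l, l'⟫_ℂ := by
    rw [InnerProductSpace.continuousLinearMapOfBilin_apply]
    rw [tmul, tmul, extend_of, ContinuousLinearMap.flip_apply, extend_of]
    exact hG h l h' l'
  rw [← inner_conj_symm, h1, inner_conj_symm]

end Sesq

namespace HTensor

theorem denseRange_rTensor_of : DenseRange ((of H K).rTensor L) := by
  have key : ∀ x : HTensor H K ⊗[ℂ] L,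
      x ∈ (LinearMap.range ((of H K).rTensor L).toLinearMap).topologicalClosure := by
    intro x
    induction x with
    | zero => exact zero_mem _
    | add a b ha hb => exact add_mem ha hb
    | tmul a l =>
      induction a using denseRange_of.induction_on with
      | hp =>
        have hc : Continuous fun a : HTensor H K => (a ⊗ₜ[ℂ] l : HTensor H K ⊗[ℂ] L) :=
          ((TensorProduct.mkL ℂ (HTensor H K) L).flip l).continuous
        exact (LinearMap.range
          ((of H K).rTensor L).toLinearMap).isClosed_topologicalClosure.preimage hc
      | ih a => exact Submodule.le_topologicalClosure _ ⟨a ⊗ₜ l, by simp⟩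
  intro x
  have := key x
  rwa [← SetLike.mem_coe, Submodule.topologicalClosure_coe] at this

theorem denseRange_lTensor_of : DenseRange ((of K L).lTensor H) := by
  have key : ∀ x : H ⊗[ℂ] HTensor K L,
      x ∈ (LinearMap.range ((of K L).lTensor H).toLinearMap).topologicalClosure := by
    intro x
    induction x with
    | zero => exact zero_mem _
    | add a b ha hb => exact add_mem ha hb
    | tmul l a =>
      induction a using denseRange_of.induction_on with
      | hp =>
        have hc : Continuous fun a : HTensor K L => (l ⊗ₜ[ℂ] a : H ⊗[ℂ] HTensor K L) :=
          (TensorProduct.mkL ℂ H (HTensor K L) l).continuous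
        exact (LinearMap.range
          ((of K L).lTensor H).toLinearMap).isClosed_topologicalClosure.preimage hc
      | ih a => exact Submodule.le_topologicalClosure _ ⟨l ⊗ₜ a, by simp⟩
  intro x
  have := key x
  rwa [← SetLike.mem_coe, Submodule.topologicalClosure_coe] at this

/-- The canonical unitary `(H ⊗ K) ⊗ L ≃ H ⊗ (K ⊗ L)`. -/
def assoc (H : Type u) (K : Type v) (L : Type w) [NormedAddCommGroup H] [InnerProductSpace ℂ H]
    [NormedAddCommGroup K] [InnerProductSpace ℂ K] [NormedAddCommGroup L]
    [InnerProductSpace ℂ L] : HTensor (HTensor H K) L ≃ₗᵢ[ℂ] HTensor H (HTensor K L) :=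
  LinearEquiv.extendOfIsometry (TensorProduct.assocIsometry ℂ H K L).toLinearEquiv
    ((of (HTensor H K) L).comp ((of H K).rTensor L)).toLinearMap
    ((of H (HTensor K L)).comp ((of K L).lTensor H)).toLinearMap
    (denseRange_of.comp denseRange_rTensor_of (of (HTensor H K) L).continuous)
    (denseRange_of.comp denseRange_lTensor_of (of H (HTensor K L)).continuous)
    fun x => by
      change ‖of H (HTensor K L) ((of K L).lTensor H (TensorProduct.assocIsometry ℂ H K L x))‖ =
        ‖of (HTensor H K) L ((of H K).rTensor L x)‖
      rw [LinearIsometry.norm_map, LinearIsometry.norm_map, LinearIsometryEquiv.norm_map,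
        LinearIsometry.norm_map, LinearIsometry.norm_map]

theorem assoc_tmul (h : H) (k : K) (l : L) :
    assoc H K L (tmul (tmul h k) l) = tmul h (tmul k l) := 
  LinearEquiv.extendOfIsometry_eq (TensorProduct.assocIsometry ℂ H K L).toLinearEquiv
    (e₁ := ((of (HTensor H K) L).comp ((of H K).rTensor L)).toLinearMap)
    (e₂ := ((of H (HTensor K L)).comp ((of K L).lTensor H)).toLinearMap)
    (denseRange_of.comp denseRange_rTensor_of (of (HTensor H K) L).continuous)
    (denseRange_of.comp denseRange_lTensor_of (of H (HTensor K L)).continuous)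
    _ ((h ⊗ₜ k) ⊗ₜ l)

/-- The flip unitary `H ⊗ K ≃ K ⊗ H`. -/
def swap (H : Type u) (K : Type v) [NormedAddCommGroup H] [InnerProductSpace ℂ H]
    [NormedAddCommGroup K] [InnerProductSpace ℂ K] : HTensor H K ≃ₗᵢ[ℂ] HTensor K H :=
  LinearEquiv.extendOfIsometry (TensorProduct.commIsometry ℂ H K).toLinearEquiv
    (of H K).toLinearMap (of K H).toLinearMap denseRange_of denseRange_of fun x => by
      change ‖of K H (TensorProduct.commIsometry ℂ H K x)‖ = ‖of H K x‖
      rw [LinearIsometry.norm_map, LinearIsometry.norm_map, LinearIsometryEquiv.norm_map]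

theorem swap_tmul (h : H) (k : K) : swap H K (tmul h k) = tmul k h :=
  LinearEquiv.extendOfIsometry_eq (TensorProduct.commIsometry ℂ H K).toLinearEquiv
    (e₁ := (of H K).toLinearMap) (e₂ := (of K H).toLinearMap) denseRange_of denseRange_of _
    (h ⊗ₜ k)

end HTensor

variable [CompleteSpace H] [CompleteSpace K] [CompleteSpace L]

theorem HTensor.adjoint_mapOp (x : H →L[ℂ] H) (y : K →L[ℂ] K) :
    ContinuousLinearMap.adjoint (mapOp x y) =
      mapOp (ContinuousLinearMap.adjoint x) (ContinuousLinearMap.adjoint y) := by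
  refine ext_tmul fun h k => ext_inner fun h' k' => ?_
  simp [ContinuousLinearMap.adjoint_inner_right, inner_tmul]

namespace VonNeumannAlgebra

instance smulMemClass : SMulMemClass (VonNeumannAlgebra H) ℂ (H →L[ℂ] H) where
  smul_mem {s} c _ hx := s.toStarSubalgebra.smul_mem hx c

theorem isClosed (M : VonNeumannAlgebra H) : IsClosed (M : Set (H →L[ℂ] H)) := by
  rw [← M.centralizer_centralizer]
  exact Set.isClosed_centralizer _

/-- The elements of a von Neumann algebra, as a type whose structure is that of a C⋆-algebra. -/
def Elt (M : VonNeumannAlgebra H) : Type u := M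

/-- The C⋆-algebra structure that a von Neumann algebra inherits from `B(H)`. -/
def eltCStarAlgebra (M : VonNeumannAlgebra H) : CStarAlgebra M.Elt :=
  StarSubalgebra.cstarAlgebra M (h_closed := M.isClosed)

instance (M : VonNeumannAlgebra H) : CStarAlgebra M.Elt := M.eltCStarAlgebra

/-- The inclusion of `M` into `B(H)`. -/
def val (M : VonNeumannAlgebra H) : M.Elt →⋆ₐ[ℂ] (H →L[ℂ] H) where
  toFun x := Subtype.val (p := (· ∈ M)) x
  map_one' := rfl
  map_mul' _ _ := rfl
  map_zero' := rfl
  map_add' _ _ := rfl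
  commutes' _ := rfl
  map_star' _ := rfl

/-- An operator in `M`, as an element of the type `M.Elt`. -/
def elt {M : VonNeumannAlgebra H} (x : H →L[ℂ] H) (hx : x ∈ M) : M.Elt := (⟨x, hx⟩ : M)

theorem val_mem {M : VonNeumannAlgebra H} (x : M.Elt) : M.val x ∈ M := Subtype.property (p := (· ∈ M)) x

@[simp] theorem val_mk {M : VonNeumannAlgebra H} (x : H →L[ℂ] H) (hx : x ∈ M) :
    M.val (elt x hx) = x := rfl

theorem val_injective (M : VonNeumannAlgebra H) : Function.Injective M.val :=
  Subtype.val_injective (p := (· ∈ M))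

theorem norm_val {M : VonNeumannAlgebra H} (x : M.Elt) : ‖M.val x‖ = ‖x‖ := rfl

/-- `M ⊗ N`: the von Neumann algebra generated by the operators `x ⊗ y`. -/
def tensor (M : VonNeumannAlgebra H) (N : VonNeumannAlgebra K) :
    VonNeumannAlgebra (HTensor H K) where
  toStarSubalgebra := StarSubalgebra.centralizer ℂ (StarSubalgebra.centralizer ℂ
    {z : HTensor H K →L[ℂ] HTensor H K | ∃ x ∈ M, ∃ y ∈ N, z = mapOp x y} :
      Set (HTensor H K →L[ℂ] HTensor H K))
  centralizer_centralizer' := by simp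

variable {M : VonNeumannAlgebra H} {N : VonNeumannAlgebra K}

theorem mem_tensor_iff {z : HTensor H K →L[ℂ] HTensor H K} :
    z ∈ M.tensor N ↔ ∀ t : HTensor H K →L[ℂ] HTensor H K,
      (∀ x ∈ M, ∀ y ∈ N, mapOp x y * t = t * mapOp x y) → t * z = z * t := by
  have hset : ({z : HTensor H K →L[ℂ] HTensor H K | ∃ x ∈ M, ∃ y ∈ N, z = mapOp x y} ∪
      star {z | ∃ x ∈ M, ∃ y ∈ N, z = mapOp x y}) = {z | ∃ x ∈ M, ∃ y ∈ N, z = mapOp x y} := by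
    rw [Set.union_eq_left]
    rintro z ⟨x, hx, y, hy, hz⟩
    refine ⟨star x, star_mem hx, star y, star_mem hy, ?_⟩
    rw [← star_star z, hz, ContinuousLinearMap.star_eq_adjoint, HTensor.adjoint_mapOp]
    rfl
  change z ∈ StarSubalgebra.centralizer ℂ _ ↔ _
  rw [StarSubalgebra.mem_centralizer_iff]
  simp only [SetLike.mem_coe, StarSubalgebra.mem_centralizer_iff]
  constructor
  · intro h t ht
    exact (h t (by
      rintro _ ⟨x, hx, y, hy, rfl⟩
      refine ⟨ht x hx y hy, ?_⟩
      have := ht (star x) (star_mem hx) (star y) (star_mem hy)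
      rw [ContinuousLinearMap.star_eq_adjoint, HTensor.adjoint_mapOp]
      exact this)).1
  · intro h t ht
    refine ⟨h t fun x hx y hy => (ht _ ⟨x, hx, y, hy, rfl⟩).1, h _ fun x hx y hy => ?_⟩
    have := congrArg star (ht _ ⟨x, hx, y, hy, rfl⟩).2
    rw [star_mul, star_mul, star_star] at this
    exact this.symm

theorem mapOp_mem_tensor {x : H →L[ℂ] H} {y : K →L[ℂ] K} (hx : x ∈ M) (hy : y ∈ N) :
    mapOp x y ∈ M.tensor N :=
  mem_tensor_iff.2 fun _ ht => (ht x hx y hy).symm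

theorem mem_iff_commutant {x : H →L[ℂ] H} : x ∈ M ↔ ∀ u ∈ M.commutant, u * x = x * u := by
  rw [← mem_commutant_iff, commutant_commutant]

theorem mapOp_mul_mapOp (x x' : H →L[ℂ] H) (y y' : K →L[ℂ] K) :
    mapOp x y * mapOp x' y' = mapOp (x * x') (y * y') :=
  ext_tmul fun h k => by simp [mul_apply_eq_comp]

theorem commute_left {z : HTensor H K →L[ℂ] HTensor H K} (hz : z ∈ M.tensor N)
    {u : H →L[ℂ] H} (hu : u ∈ M.commutant) : mapOp u 1 * z = z * mapOp u 1 :=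
  mem_tensor_iff.1 hz _ fun x hx y _ => by
    rw [mapOp_mul_mapOp, mapOp_mul_mapOp, mem_commutant_iff.1 hu x hx, one_mul, mul_one]

theorem commute_right {z : HTensor H K →L[ℂ] HTensor H K} (hz : z ∈ M.tensor N)
    {u : K →L[ℂ] K} (hu : u ∈ N.commutant) : mapOp 1 u * z = z * mapOp 1 u :=
  mem_tensor_iff.1 hz _ fun x _ y hy => by
    rw [mapOp_mul_mapOp, mapOp_mul_mapOp, mem_commutant_iff.1 hu y hy, one_mul, mul_one]

end VonNeumannAlgebra

open VonNeumannAlgebra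

/-- `(ω_{h',h} ⊗ ι)(z)`, where `ω_{h',h}(x) = ⟪h', x h⟫`. -/
def vecSliceL (h' h : H) (z : HTensor H K →L[ℂ] HTensor H K) : K →L[ℂ] K :=
  ContinuousLinearMap.adjoint (creL K h') ∘L z ∘L creL K h

/-- `(ι ⊗ ω_{k',k})(z)`, where `ω_{k',k}(y) = ⟪k', y k⟫`. -/
def vecSliceR (k' k : K) (z : HTensor H K →L[ℂ] HTensor H K) : H →L[ℂ] H :=
  ContinuousLinearMap.adjoint (creR H k') ∘L z ∘L creR H k

theorem inner_vecSliceL (h' h : H) (z : HTensor H K →L[ℂ] HTensor H K) (k' k : K) :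
    ⟪k', vecSliceL h' h z k⟫_ℂ = ⟪tmul h' k', z (tmul h k)⟫_ℂ := by
  simp [vecSliceL, ContinuousLinearMap.adjoint_inner_right]

theorem inner_vecSliceR (k' k : K) (z : HTensor H K →L[ℂ] HTensor H K) (h' h : H) :
    ⟪h', vecSliceR k' k z h⟫_ℂ = ⟪tmul h' k', z (tmul h k)⟫_ℂ := by
  simp [vecSliceR, ContinuousLinearMap.adjoint_inner_right]

theorem norm_vecSliceR_le (k' k : K) (z : HTensor H K →L[ℂ] HTensor H K) :
    ‖vecSliceR k' k z‖ ≤ ‖z‖ * ‖k'‖ * ‖k‖ := by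
  refine (ContinuousLinearMap.opNorm_comp_le _ _).trans ?_
  rw [LinearIsometryEquiv.norm_map, mul_comm ‖z‖, mul_assoc]
  gcongr
  · exact norm_creR_le k'
  · exact (ContinuousLinearMap.opNorm_comp_le _ _).trans (by gcongr; exact norm_creR_le k)

variable {M : VonNeumannAlgebra H} {N : VonNeumannAlgebra K}

theorem vecSliceL_mem (h' h : H) {z : HTensor H K →L[ℂ] HTensor H K} (hz : z ∈ M.tensor N) :
    vecSliceL h' h z ∈ N := by
  refine mem_iff_commutant.2 fun u hu => ?_
  ext k
  refine ext_inner_left ℂ fun k' => ?_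
  have := congrArg (fun f => ⟪tmul h' k', f (tmul h k)⟫_ℂ) (commute_right hz hu)
  change ⟪tmul h' k', mapOp 1 u (z (tmul h k))⟫_ℂ =
    ⟪tmul h' k', z (mapOp 1 u (tmul h k))⟫_ℂ at this
  rw [mapOp_tmul, one_apply_eq_self] at this
  change ⟪k', u (vecSliceL h' h z k)⟫_ℂ = ⟪k', vecSliceL h' h z (u k)⟫_ℂ
  rw [inner_vecSliceL, ← this, ← ContinuousLinearMap.adjoint_inner_left, inner_vecSliceL,
    ← ContinuousLinearMap.adjoint_inner_left (mapOp 1 u), adjoint_mapOp, mapOp_tmul,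
    ← ContinuousLinearMap.star_eq_adjoint 1, star_one, one_apply_eq_self]

theorem vecSliceR_mem (k' k : K) {z : HTensor H K →L[ℂ] HTensor H K} (hz : z ∈ M.tensor N) :
    vecSliceR k' k z ∈ M := by
  refine mem_iff_commutant.2 fun u hu => ?_
  ext h
  refine ext_inner_left ℂ fun h' => ?_
  have := congrArg (fun f => ⟪tmul h' k', f (tmul h k)⟫_ℂ) (commute_left hz hu)
  change ⟪tmul h' k', mapOp u 1 (z (tmul h k))⟫_ℂ =
    ⟪tmul h' k', z (mapOp u 1 (tmul h k))⟫_ℂ at this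
  rw [mapOp_tmul, one_apply_eq_self] at this
  change ⟪h', u (vecSliceR k' k z h)⟫_ℂ = ⟪h', vecSliceR k' k z (u h)⟫_ℂ
  rw [inner_vecSliceR, ← this, ← ContinuousLinearMap.adjoint_inner_left, inner_vecSliceR,
    ← ContinuousLinearMap.adjoint_inner_left (mapOp u 1), adjoint_mapOp, mapOp_tmul,
    ← ContinuousLinearMap.star_eq_adjoint 1, star_one, one_apply_eq_self]

theorem vecSliceL_add_left (h₁ h₂ h : H) (z : HTensor H K →L[ℂ] HTensor H K) :
    vecSliceL (h₁ + h₂) h z = vecSliceL h₁ h z + vecSliceL h₂ h z := by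
  simp [vecSliceL, creL_add, ContinuousLinearMap.add_comp]
theorem vecSliceL_add_right (h' h₁ h₂ : H) (z : HTensor H K →L[ℂ] HTensor H K) :
    vecSliceL h' (h₁ + h₂) z = vecSliceL h' h₁ z + vecSliceL h' h₂ z := by
  simp [vecSliceL, creL_add, ContinuousLinearMap.comp_add]
theorem vecSliceL_smul_left (c : ℂ) (h' h : H) (z : HTensor H K →L[ℂ] HTensor H K) :
    vecSliceL (c • h') h z = conj c • vecSliceL h' h z := by
  rw [vecSliceL, creL_smul, map_smulₛₗ, ContinuousLinearMap.smul_comp]; rfl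
theorem vecSliceL_smul_right (c : ℂ) (h' h : H) (z : HTensor H K →L[ℂ] HTensor H K) :
    vecSliceL h' (c • h) z = c • vecSliceL h' h z := by
  simp [vecSliceL, creL_smul]
theorem vecSliceR_add_left (h₁ h₂ h : K) (z : HTensor H K →L[ℂ] HTensor H K) :
    vecSliceR (h₁ + h₂) h z = vecSliceR h₁ h z + vecSliceR h₂ h z := by
  simp [vecSliceR, creR_add, ContinuousLinearMap.add_comp]
theorem vecSliceR_add_right (h' h₁ h₂ : K) (z : HTensor H K →L[ℂ] HTensor H K) :
    vecSliceR h' (h₁ + h₂) z = vecSliceR h' h₁ z + vecSliceR h' h₂ z := by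
  simp [vecSliceR, creR_add, ContinuousLinearMap.comp_add]
theorem vecSliceR_smul_left (c : ℂ) (h' h : K) (z : HTensor H K →L[ℂ] HTensor H K) :
    vecSliceR (c • h') h z = conj c • vecSliceR h' h z := by
  rw [vecSliceR, creR_smul, map_smulₛₗ, ContinuousLinearMap.smul_comp]; rfl
theorem vecSliceR_smul_right (c : ℂ) (h' h : K) (z : HTensor H K →L[ℂ] HTensor H K) :
    vecSliceR h' (c • h) z = c • vecSliceR h' h z := by
  simp [vecSliceR, creR_smul]

/-- `vecSliceL` as a map into `N`. -/
def sliceVecL (h' h : H) (z : (M.tensor N).Elt) : N.Elt :=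
  elt (vecSliceL h' h ((M.tensor N).val z)) (vecSliceL_mem h' h (val_mem z))

/-- `vecSliceR` as a map into `M`. -/
def sliceVecR (k' k : K) (z : (M.tensor N).Elt) : M.Elt :=
  elt (vecSliceR k' k ((M.tensor N).val z)) (vecSliceR_mem k' k (val_mem z))

/-- The sesquilinear form `(k', k) ↦ ω ((ι ⊗ ω_{k',k})(z))`. -/
def sliceForm (ω : StrongDual ℂ M.Elt) (z : (M.tensor N).Elt) : K →ₗ⋆[ℂ] K →ₗ[ℂ] ℂ :=
  LinearMap.mk₂'ₛₗ (starRingEnd ℂ) (RingHom.id ℂ) (fun k' k => ω (sliceVecR k' k z))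
    (fun k₁ k₂ k => by
      have : sliceVecR (k₁ + k₂) k z = sliceVecR k₁ k z + sliceVecR k₂ k z :=
        M.val_injective (vecSliceR_add_left k₁ k₂ k _)
      rw [this, map_add])
    (fun c k' k => by
      have : sliceVecR (c • k') k z = conj c • sliceVecR k' k z :=
        M.val_injective (vecSliceR_smul_left c k' k _)
      rw [this, map_smul])
    (fun k' k₁ k₂ => by
      have : sliceVecR k' (k₁ + k₂) z = sliceVecR k' k₁ z + sliceVecR k' k₂ z :=
        M.val_injective (vecSliceR_add_right k' k₁ k₂ _)
      rw [this, map_add])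
    (fun c k' k => by
      have : sliceVecR k' (c • k) z = c • sliceVecR k' k z :=
        M.val_injective (vecSliceR_smul_right c k' k _)
      rw [this, map_smul, RingHom.id_apply])

theorem norm_sliceForm_le (ω : StrongDual ℂ M.Elt) (z : (M.tensor N).Elt) (k' k : K) :
    ‖sliceForm ω z k' k‖ ≤ ‖ω‖ * ‖z‖ * ‖k'‖ * ‖k‖ := by
  refine (ω.le_opNorm (sliceVecR k' k z)).trans ?_
  rw [mul_assoc, mul_assoc, ← mul_assoc ‖z‖]
  exact mul_le_mul_of_nonneg_left (norm_vecSliceR_le k' k _) (norm_nonneg _)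

/-- The slice `(ω ⊗ ι)(z) ∈ B(K)`, given by `⟪k', (ω ⊗ ι)(z) k⟫ = ω ((ι ⊗ ω_{k',k})(z))`. -/
def sliceOp (ω : StrongDual ℂ M.Elt) (z : (M.tensor N).Elt) : K →L[ℂ] K :=
  ContinuousLinearMap.adjoint (InnerProductSpace.continuousLinearMapOfBilin
    ((sliceForm ω z).mkContinuous₂ (‖ω‖ * ‖z‖) (norm_sliceForm_le ω z)))

theorem inner_sliceOp (ω : StrongDual ℂ M.Elt) (z : (M.tensor N).Elt) (k' k : K) :
    ⟪k', sliceOp ω z k⟫_ℂ = ω (sliceVecR k' k z) := by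
  rw [sliceOp, ContinuousLinearMap.adjoint_inner_right,
    InnerProductSpace.continuousLinearMapOfBilin_apply]
  rfl

theorem norm_sliceOp_le (ω : StrongDual ℂ M.Elt) (z : (M.tensor N).Elt) :
    ‖sliceOp ω z‖ ≤ ‖ω‖ * ‖z‖ := by
  refine ContinuousLinearMap.opNorm_le_of_re_inner_le (by positivity) fun x y hx hy => ?_
  refine (RCLike.re_le_norm _).trans ?_
  rw [← inner_conj_symm, RCLike.norm_conj, inner_sliceOp]
  simpa [hx, hy] using! norm_sliceForm_le ω z y x

theorem sliceOp_mem (ω : StrongDual ℂ M.Elt) (z : (M.tensor N).Elt) : sliceOp ω z ∈ N := by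
  refine mem_iff_commutant.2 fun u hu => ?_
  ext k
  refine ext_inner_left ℂ fun k' => ?_
  change ⟪k', u (sliceOp ω z k)⟫_ℂ = ⟪k', sliceOp ω z (u k)⟫_ℂ
  rw [← ContinuousLinearMap.adjoint_inner_left, inner_sliceOp, inner_sliceOp]
  congr 1
  refine M.val_injective ?_
  change vecSliceR _ _ _ = vecSliceR _ _ _
  ext h
  refine ext_inner_left ℂ fun h' => ?_
  have := congrArg (fun f => ⟪tmul h' k', f (tmul h k)⟫_ℂ) (commute_right (val_mem z) hu)
  change ⟪tmul h' k', mapOp 1 u ((M.tensor N).val z (tmul h k))⟫_ℂ =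
    ⟪tmul h' k', (M.tensor N).val z (mapOp 1 u (tmul h k))⟫_ℂ at this
  rw [mapOp_tmul, one_apply_eq_self] at this
  rw [inner_vecSliceR, inner_vecSliceR, ← this,
    ← ContinuousLinearMap.adjoint_inner_left (mapOp 1 u),
    adjoint_mapOp, mapOp_tmul, ← ContinuousLinearMap.star_eq_adjoint 1, star_one,
    one_apply_eq_self]

/-- The slice map `ω ⊗ ι : M ⊗ N → N`. -/
def slice (N : VonNeumannAlgebra K) (ω : StrongDual ℂ M.Elt) : (M.tensor N).Elt →L[ℂ] N.Elt :=
  LinearMap.mkContinuous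
    { toFun := fun z => elt (sliceOp ω z) (sliceOp_mem ω z)
      map_add' := fun z z' => by
        refine N.val_injective (ContinuousLinearMap.ext fun k => ext_inner_left ℂ fun k' => ?_)
        change ⟪k', sliceOp ω (z + z') k⟫_ℂ = ⟪k', sliceOp ω z k + sliceOp ω z' k⟫_ℂ
        rw [inner_add_right, inner_sliceOp, inner_sliceOp, inner_sliceOp, ← map_add]
        congr 1
        refine M.val_injective ?_
        simp [sliceVecR, vecSliceR, ContinuousLinearMap.add_comp, ContinuousLinearMap.comp_add]
      map_smul' := fun c z => by
        refine N.val_injective (ContinuousLinearMap.ext fun k => ext_inner_left ℂ fun k' => ?_)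
        change ⟪k', sliceOp ω (c • z) k⟫_ℂ = ⟪k', c • sliceOp ω z k⟫_ℂ
        rw [inner_smul_right, inner_sliceOp, inner_sliceOp, ← smul_eq_mul, ← map_smul ω]
        congr 1
        refine M.val_injective ?_
        simp [sliceVecR, vecSliceR, ContinuousLinearMap.smul_comp] }
    ‖ω‖ (norm_sliceOp_le ω)

theorem inner_slice (ω : StrongDual ℂ M.Elt) (z : (M.tensor N).Elt) (k' k : K) :
    ⟪k', N.val (slice N ω z) k⟫_ℂ = ω (sliceVecR k' k z) :=
  inner_sliceOp ω z k' k

section Amplification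

/-- If `z` on `H ⊗ K` has entries in (a faithful copy of) a C⋆-algebra `A`, then applying a
`*`-homomorphism `T : A → B(L)` entrywise gives a bounded operator on `H ⊗ L`. -/
theorem exists_amp {A : Type*} [CStarAlgebra A] (ρ : A →⋆ₙₐ[ℂ] (K →L[ℂ] K))
    (hρ : Function.Injective ρ) (z : HTensor H K →L[ℂ] HTensor H K) (S : H →ₗ⋆[ℂ] H →ₗ[ℂ] A)
    (hz : ∀ h' h k' k, ⟪tmul h' k', z (tmul h k)⟫_ℂ = ⟪k', ρ (S h' h) k⟫_ℂ)
    (T : A →⋆ₙₐ[ℂ] (L →L[ℂ] L)) :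
    ∃ w : HTensor H L →L[ℂ] HTensor H L, ∀ h' h l' l,
      ⟪tmul h' l', w (tmul h l)⟫_ℂ = ⟪l', T (S h' h) l⟫_ℂ := by
  letI := CStarAlgebra.spectralOrder A
  letI := CStarAlgebra.spectralOrderedRing A
  let T' : H →ₗ⋆[ℂ] H →ₗ[ℂ] (L →L[ℂ] L) := LinearMap.mk₂'ₛₗ (starRingEnd ℂ) (RingHom.id ℂ)
    (fun h' h => T (S h' h)) (by intros; simp) (by intros; simp) (by intros; simp)
    (by intros; simp)
  refine exists_op_of_kernel T' ‖z‖ fun n e he l l' => ?_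
  let Z : CStarMatrix (Fin n) (Fin n) A := CStarMatrix.ofMatrix fun j i => S (e j) (e i)
  have h1 : ∑ j, ∑ i, ⟪l' j, T' (e j) (e i) (l i)⟫_ℂ =
      ⟪l', blockHom (L := L) n (CStarMatrix.mapₙₐ T Z) l⟫_ℂ := by
    rw [PiLp.inner_apply]
    refine Finset.sum_congr rfl fun j _ => ?_
    change _ = ⟪l' j, blockOp _ l j⟫_ℂ
    rw [blockOp_apply, inner_sum]
    rfl
  have h2 : ‖blockHom (L := L) n (CStarMatrix.mapₙₐ T Z)‖ ≤ ‖Z‖ :=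
    (NonUnitalStarAlgHom.norm_apply_le (blockHom (L := L) n) _).trans
      (NonUnitalStarAlgHom.norm_apply_le (CStarMatrix.mapₙₐ T) Z)
  have h3 : ‖Z‖ = ‖blockHom (L := K) n (CStarMatrix.mapₙₐ ρ Z)‖ := by
    rw [NonUnitalStarAlgHom.norm_map (blockHom (L := K) n) (blockHom_injective n)]
    exact (NonUnitalStarAlgHom.norm_map (CStarMatrix.mapₙₐ (n := Fin n) ρ)
      (CStarMatrix.map_injective hρ) Z).symm
  have hnorm (k : PiLp 2 (fun _ : Fin n => K)) : ‖∑ i, tmul (e i) (k i)‖ = ‖k‖ := by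
    have : ⟪∑ i, tmul (e i) (k i), ∑ i, tmul (e i) (k i)⟫_ℂ = ⟪k, k⟫_ℂ := by
      simp only [PiLp.inner_apply, sum_inner, inner_sum, inner_tmul, orthonormal_iff_ite.1 he]
      simp
    rw [@norm_eq_sqrt_re_inner ℂ, this, ← @norm_eq_sqrt_re_inner ℂ]
  have h4 : ‖blockHom (L := K) n (CStarMatrix.mapₙₐ ρ Z)‖ ≤ ‖z‖ := by
    refine ContinuousLinearMap.opNorm_le_of_re_inner_le (norm_nonneg _) fun x y hx hy => ?_
    have h5 : ⟪y, blockHom (L := K) n (CStarMatrix.mapₙₐ ρ Z) x⟫_ℂ =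
        ⟪∑ j, tmul (e j) (y j), z (∑ i, tmul (e i) (x i))⟫_ℂ := by
      rw [PiLp.inner_apply]
      simp only [map_sum, sum_inner, inner_sum, hz]
      rw [Finset.sum_comm]
      refine Finset.sum_congr rfl fun j _ => ?_
      change ⟪y j, blockOp _ x j⟫_ℂ = _
      rw [blockOp_apply, inner_sum]
      rfl
    refine (RCLike.re_le_norm _).trans ?_
    rw [← inner_conj_symm, RCLike.norm_conj, h5]
    refine (norm_inner_le_norm _ _).trans ?_
    rw [hnorm, hy, one_mul]
    refine (z.le_opNorm _).trans ?_
    rw [hnorm, hx, mul_one]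
  rw [h1]
  refine (norm_inner_le_norm _ _).trans ?_
  rw [mul_comm]
  gcongr
  exact (ContinuousLinearMap.le_opNorm _ _).trans
    (mul_le_mul_of_nonneg_right (h2.trans (h3.le.trans h4)) (norm_nonneg _))

theorem exists_ampR (T : M.Elt →⋆ₙₐ[ℂ] (L →L[ℂ] L)) (z : (M.tensor N).Elt) :
    ∃ w : HTensor L K →L[ℂ] HTensor L K, ∀ l' l k' k,
      ⟪tmul l' k', w (tmul l k)⟫_ℂ = ⟪l', T (sliceVecR k' k z) l⟫_ℂ := by
  obtain ⟨w, hw⟩ := exists_amp (H := K) (K := H) (A := M.Elt) (M.val : M.Elt →⋆ₙₐ[ℂ] (H →L[ℂ] H))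
    M.val_injective
    ((swap H K).toContinuousLinearEquiv.toContinuousLinearMap ∘L (M.tensor N).val z ∘L
      (swap K H).toContinuousLinearEquiv.toContinuousLinearMap)
    (LinearMap.mk₂'ₛₗ (starRingEnd ℂ) (RingHom.id ℂ) (fun k' k => sliceVecR k' k z)
      (fun k₁ k₂ k => M.val_injective (vecSliceR_add_left k₁ k₂ k _))
      (fun c k' k => M.val_injective (vecSliceR_smul_left c k' k _))
      (fun k' k₁ k₂ => M.val_injective (vecSliceR_add_right k' k₁ k₂ _))
      (fun c k' k => M.val_injective (vecSliceR_smul_right c k' k _)))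
    (fun k' k h' h => by
      change ⟪tmul k' h', swap H K ((M.tensor N).val z (swap K H (tmul k h)))⟫_ℂ =
        ⟪h', vecSliceR k' k _ h⟫_ℂ
      rw [inner_vecSliceR, swap_tmul, ← swap_tmul h' k', LinearIsometryEquiv.inner_map_map]) T
  refine ⟨(swap K L).toContinuousLinearEquiv.toContinuousLinearMap ∘L w ∘L
      (swap L K).toContinuousLinearEquiv.toContinuousLinearMap, fun l' l k' k => ?_⟩
  change ⟪tmul l' k', swap K L (w (swap L K (tmul l k)))⟫_ℂ = _
  rw [swap_tmul, ← swap_tmul k' l', LinearIsometryEquiv.inner_map_map, hw]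
  rfl

theorem exists_ampL (T : N.Elt →⋆ₙₐ[ℂ] (L →L[ℂ] L)) (z : (M.tensor N).Elt) :
    ∃ w : HTensor H L →L[ℂ] HTensor H L, ∀ h' h l' l,
      ⟪tmul h' l', w (tmul h l)⟫_ℂ = ⟪l', T (sliceVecL h' h z) l⟫_ℂ :=
  exists_amp (A := N.Elt) (N.val : N.Elt →⋆ₙₐ[ℂ] (K →L[ℂ] K)) N.val_injective ((M.tensor N).val z)
    (LinearMap.mk₂'ₛₗ (starRingEnd ℂ) (RingHom.id ℂ) (fun h' h => sliceVecL h' h z)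
      (fun h₁ h₂ h => N.val_injective (vecSliceL_add_left h₁ h₂ h _))
      (fun c h' h => N.val_injective (vecSliceL_smul_left c h' h _))
      (fun h' h₁ h₂ => N.val_injective (vecSliceL_add_right h' h₁ h₂ _))
      (fun c h' h => N.val_injective (vecSliceL_smul_right c h' h _)))
    (fun h' h k' k => (inner_vecSliceL h' h _ k' k).symm) T

end Amplification

/-- `(ι ⊗ T)(z)` for a `*`-homomorphism `T : N → B(L)` and `z ∈ M ⊗ N`: the bounded operator on
`H ⊗ L` with `(ω_{h',h} ⊗ ι)((ι ⊗ T)(z)) = T ((ω_{h',h} ⊗ ι)(z))` for all `h', h`. -/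
def ampL (T : N.Elt →⋆ₙₐ[ℂ] (L →L[ℂ] L)) (z : (M.tensor N).Elt) :
    HTensor H L →L[ℂ] HTensor H L := (exists_ampL T z).choose

theorem inner_ampL (T : N.Elt →⋆ₙₐ[ℂ] (L →L[ℂ] L)) (z : (M.tensor N).Elt) (h' h : H) (l' l : L) :
    ⟪tmul h' l', ampL T z (tmul h l)⟫_ℂ = ⟪l', T (sliceVecL h' h z) l⟫_ℂ :=
  (exists_ampL T z).choose_spec h' h l' l

/-- `(T ⊗ ι)(z)` for a `*`-homomorphism `T : M → B(L)` and `z ∈ M ⊗ N`: the bounded operator on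
`L ⊗ K` with `(ι ⊗ ω_{k',k})((T ⊗ ι)(z)) = T ((ι ⊗ ω_{k',k})(z))` for all `k', k`. -/
def ampR (T : M.Elt →⋆ₙₐ[ℂ] (L →L[ℂ] L)) (z : (M.tensor N).Elt) :
    HTensor L K →L[ℂ] HTensor L K := (exists_ampR T z).choose

theorem inner_ampR (T : M.Elt →⋆ₙₐ[ℂ] (L →L[ℂ] L)) (z : (M.tensor N).Elt) (l' l : L) (k' k : K) :
    ⟪tmul l' k', ampR T z (tmul l k)⟫_ℂ = ⟪l', T (sliceVecR k' k z) l⟫_ℂ :=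
  (exists_ampR T z).choose_spec l' l k' k

namespace VonNeumannAlgebra

/-- The predual `M_*`, as the set of normal functionals in the dual `M^*` (whose norm it carries):
the functionals `x ↦ ∑ ⟪η n, x (ξ n)⟫` with square-summable `ξ`, `η`. -/
def predual (M : VonNeumannAlgebra H) : Set (StrongDual ℂ M.Elt) :=
  {f | ∃ ξ η : ℕ → H, Summable (fun n => ‖ξ n‖ ^ 2) ∧ Summable (fun n => ‖η n‖ ^ 2) ∧
    ∀ x, HasSum (fun n => ⟪η n, M.val x (ξ n)⟫_ℂ) (f x)}

/-- A state of `M`: a positive functional taking the value `1` at the identity. -/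
def IsState (f : StrongDual ℂ M.Elt) : Prop :=
  (∀ x, (M.val x).IsPositive → 0 ≤ f x) ∧ f 1 = 1

/-- A state (or mean) on a linear subspace `X` of `M`: a positive functional of norm one. If `X` is
self-adjoint and contains the identity, the norm condition amounts to `f 1 = 1`. -/
def IsStateOn (X : Submodule ℂ M.Elt) (f : StrongDual ℂ X) : Prop :=
  (∀ x : X, (M.val x).IsPositive → 0 ≤ f x) ∧ ‖f‖ = 1

/-- A `*`-homomorphism of von Neumann algebras as a bounded linear map. -/
def homL (T : M.Elt →⋆ₙₐ[ℂ] N.Elt) : M.Elt →L[ℂ] N.Elt :=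
  LinearMap.mkContinuous (T : M.Elt →ₗ[ℂ] N.Elt) 1 fun x => by
    rw [one_mul]
    exact NonUnitalStarAlgHom.norm_apply_le T x

/-- Normality of a `*`-homomorphism: its adjoint maps the predual into the predual. -/
def IsNormalHom (T : M.Elt →⋆ₙₐ[ℂ] N.Elt) : Prop :=
  ∀ f ∈ N.predual, f ∘L homL T ∈ M.predual

/-- The functional `ω ⊗ ν` on `M ⊗ N`. -/
def prodFun (ω : StrongDual ℂ M.Elt) (ν : StrongDual ℂ N.Elt) : StrongDual ℂ (M.tensor N).Elt :=
  ν ∘L slice N ω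

end VonNeumannAlgebra

/-- A Hopf–von Neumann algebra `(M, Γ)` with `M ⊆ B(H)`. The last field is
`(ι ⊗ Γ)Γ = (Γ ⊗ ι)Γ`, up to the canonical identification of `(H ⊗ H) ⊗ H` with `H ⊗ (H ⊗ H)`. -/
structure HopfVonNeumannAlgebra (H : Type u) [NormedAddCommGroup H] [InnerProductSpace ℂ H]
    [CompleteSpace H] where
  alg : VonNeumannAlgebra H
  comul : alg.Elt →⋆ₐ[ℂ] (alg.tensor alg).Elt
  normal : IsNormalHom (comul : alg.Elt →⋆ₙₐ[ℂ] (alg.tensor alg).Elt)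
  coassoc : ∀ (x : alg.Elt) (v : HTensor (HTensor H H) H),
    ampL (((alg.tensor alg).val.comp comul : alg.Elt →⋆ₐ[ℂ] _) : alg.Elt →⋆ₙₐ[ℂ] _) (comul x)
        (HTensor.assoc H H H v) =
      HTensor.assoc H H H
        (ampR (((alg.tensor alg).val.comp comul : alg.Elt →⋆ₐ[ℂ] _) : alg.Elt →⋆ₙₐ[ℂ] _)
          (comul x) v)

/-- A left action `α : N → M ⊗ N` of `(M, Γ)` on `N`: a normal injective (not necessarily unital)
`*`-homomorphism with `(ι ⊗ α)α = (Γ ⊗ ι)α`, up to the canonical identification of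
`(H ⊗ H) ⊗ K` with `H ⊗ (H ⊗ K)`. -/
structure LeftAction (Q : HopfVonNeumannAlgebra H) (N : VonNeumannAlgebra K) where
  hom : N.Elt →⋆ₙₐ[ℂ] (Q.alg.tensor N).Elt
  injective : Function.Injective hom
  normal : IsNormalHom hom
  coassoc : ∀ (y : N.Elt) (v : HTensor (HTensor H H) K),
    ampL (((Q.alg.tensor N).val : _ →⋆ₙₐ[ℂ] _).comp hom) (hom y) (HTensor.assoc H H K v) =
      HTensor.assoc H H K
        (ampR (((Q.alg.tensor Q.alg).val.comp Q.comul : Q.alg.Elt →⋆ₐ[ℂ] _) :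
          Q.alg.Elt →⋆ₙₐ[ℂ] _) (hom y) v)

namespace HopfVonNeumannAlgebra

/-- The product `(ω * ω')(x) = (ω ⊗ ω')(Γ x)`. -/
def conv (Q : HopfVonNeumannAlgebra H) (ω ω' : StrongDual ℂ Q.alg.Elt) : StrongDual ℂ Q.alg.Elt :=
  prodFun ω ω' ∘L homL (Q.comul : Q.alg.Elt →⋆ₙₐ[ℂ] (Q.alg.tensor Q.alg).Elt)

/-- `M_*` has a (two-sided) approximate identity consisting of states; since states have norm one
it is automatically bounded. -/
def HasStateApproxIdentity (Q : HopfVonNeumannAlgebra H) : Prop :=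
  ∃ (I : Type u) (_ : Preorder I) (_ : IsDirectedOrder I) (_ : Nonempty I)
    (e : I → StrongDual ℂ Q.alg.Elt),
    (∀ i, e i ∈ Q.alg.predual ∧ IsState (e i)) ∧
    ∀ ω ∈ Q.alg.predual,
      Filter.Tendsto (fun i => Q.conv (e i) ω) Filter.atTop (nhds ω) ∧
      Filter.Tendsto (fun i => Q.conv ω (e i)) Filter.atTop (nhds ω)

end HopfVonNeumannAlgebra

namespace LeftAction

variable {Q : HopfVonNeumannAlgebra H} (α : LeftAction Q N)

/-- The element `(ω ⊗ ι)(α y)` of `N`. -/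
def act (ω : StrongDual ℂ Q.alg.Elt) (y : N.Elt) : N.Elt := slice N ω (α.hom y)

/-- The functional `α_*(ω ⊗ ν)` on `N`. -/
def pre (ω : StrongDual ℂ Q.alg.Elt) (ν : StrongDual ℂ N.Elt) : StrongDual ℂ N.Elt :=
  prodFun ω ν ∘L homL α.hom

/-- Reiter's property `FP₁`. -/
def ReiterFP1 : Prop :=
  ∀ ε : ℝ, 0 < ε → ∀ F : Finset (StrongDual ℂ Q.alg.Elt), (∀ ω ∈ F, ω ∈ Q.alg.predual) →
    ∃ ν ∈ N.predual, IsState ν ∧ ∀ ω ∈ F, ‖α.pre ω ν - ω 1 • ν‖ < ε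

/-- Left amenability of `(N, α)`. -/
def LeftAmenable : Prop :=
  ∃ m : StrongDual ℂ N.Elt, IsState m ∧ ∀ ω ∈ Q.alg.predual, ∀ y, m (α.act ω y) = ω 1 * m y

/-- The closed subspace `LUC(N, α)`. -/
def LUC : Submodule ℂ N.Elt :=
  (Submodule.span ℂ {x | ∃ ω ∈ Q.alg.predual, ∃ y, x = α.act ω y}).topologicalClosure

theorem act_mem_LUC {ω : StrongDual ℂ Q.alg.Elt} (hω : ω ∈ Q.alg.predual) (y : N.Elt) :
    α.act ω y ∈ α.LUC :=
  Submodule.le_topologicalClosure _ (Submodule.subset_span ⟨ω, hω, y, rfl⟩)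

/-- There is a left invariant mean on `LUC(N, α)`. -/
def HasLUCMean : Prop :=
  ∃ m : StrongDual ℂ α.LUC, IsStateOn α.LUC m ∧
    ∀ (ω : StrongDual ℂ Q.alg.Elt) (hω : ω ∈ Q.alg.predual) (y : α.LUC),
      m ⟨α.act ω y, α.act_mem_LUC hω y⟩ = ω 1 * m y

end LeftAction

end

/-!
Throughout, `y ↦ α.act ω y = (ω ⊗ ι)(α y)` is the (right) action of the Banach algebra `M_*` on `N`,
and `α.pre ω ν = ν ∘ α.act ω` is its dual.

*Reiter's property implies amenability.* States have norm at most one, so by Banach–Alaoglu a net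
of asymptotically invariant normal states has a weak-* cluster point, which is an invariant state
(`ReiterFP1.leftAmenable`).

*Amenability implies Reiter's property* (`LeftAmenable.reiterFP1`). Given finitely many normal
`ω`, the tuples `(α.pre ω ν - ω(1) ν)_ω`, with `ν` ranging over the normal states, form a convex set.
If it stayed away from `0` in norm, Hahn–Banach would give a functional on a finite power of `N^*`
separating the two. A functional on `N^*` acts on the predual as evaluation at an element of `N`
(`exists_eval_of_predual`), so the separation says that some
`x = ∑ ω, (α.act ω (y ω) - ω(1) y ω)` has `re ν(x) ≥ c > 0` for every normal state `ν`. Applied to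
vector states this bounds the numerical range of `x`, hence `re m(x) ≥ c` for every state `m`
(`mul_re_one_le_re`), whereas an invariant state vanishes at `x`.

*Amenability gives a mean on `LUC`* by restriction. As `α` may be non-unital, that the restriction
has norm one is seen at `α.act ω 1`, for a normal state `ω`.

*From `LUC` to `N`.* Coassociativity gives `α.act (ω * ω') y = α.act ω' (α.act ω y)` (`act_conv`);
since it is phrased with vector functionals, this needs the absolutely convergent double series
for `ω ⊗ ν` (`hasSum_prodFun`) and the normality of `α`. If `m₀` is a mean on `LUC` and `e` an
approximate identity of states, then
`m₀ (α.act ω y) = lim m₀ (α.act (e i * ω) y) = lim m₀ (α.act ω (α.act (e i) y))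
  = ω(1) lim m₀ (α.act (e i) y)`.
Hence `m₀ (α.act (e i) y)` is independent of `i`, and as a function of `y` it is an invariant state
(`HasLUCMean.leftAmenable`).
-/

open scoped TensorProduct InnerProductSpace InnerProduct ComplexOrder ComplexConjugate

open HTensor VonNeumannAlgebra Filter Topology

/-! ### Normal functionals -/

namespace VonNeumannAlgebra

section Predual

variable {H : Type*} [NormedAddCommGroup H] [InnerProductSpace ℂ H] [CompleteSpace H]
  {K : Type*} [NormedAddCommGroup K] [InnerProductSpace ℂ K] [CompleteSpace K]
  {M : VonNeumannAlgebra H} {N : VonNeumannAlgebra K}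

theorem norm_inner_val_le (η ξ : H) (x : M.Elt) :
    ‖⟪η, M.val x ξ⟫_ℂ‖ ≤ ‖η‖ * ‖ξ‖ * ‖x‖ := by
  calc ‖⟪η, M.val x ξ⟫_ℂ‖ ≤ ‖η‖ * (‖M.val x‖ * ‖ξ‖) :=
        (norm_inner_le_norm _ _).trans (by gcongr; exact (M.val x).le_opNorm ξ)
    _ = ‖η‖ * ‖ξ‖ * ‖x‖ := by rw [norm_val]; ring

/-- The vector functional `x ↦ ⟪η, x ξ⟫` on `M`. -/
noncomputable def vecFun (M : VonNeumannAlgebra H) (η ξ : H) : StrongDual ℂ M.Elt :=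
  LinearMap.mkContinuous
    { toFun := fun x => ⟪η, M.val x ξ⟫_ℂ
      map_add' := fun x y => by simp
      map_smul' := fun c x => by simp }
    (‖η‖ * ‖ξ‖) (norm_inner_val_le η ξ)

theorem vecFun_apply (η ξ : H) (x : M.Elt) : vecFun M η ξ x = ⟪η, M.val x ξ⟫_ℂ := rfl

theorem norm_vecFun_le (η ξ : H) : ‖vecFun M η ξ‖ ≤ ‖η‖ * ‖ξ‖ :=
  LinearMap.mkContinuous_norm_le _ (by positivity) _

theorem summable_norm_mul_norm {ι E : Type*} [SeminormedAddCommGroup E] {ξ η : ι → E}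
    (hξ : Summable fun n => ‖ξ n‖ ^ 2) (hη : Summable fun n => ‖η n‖ ^ 2) :
    Summable fun n => ‖η n‖ * ‖ξ n‖ :=
  Summable.of_nonneg_of_le (fun _ => by positivity)
    (fun n => by nlinarith [sq_nonneg (‖η n‖ - ‖ξ n‖), sq_nonneg ‖η n‖, sq_nonneg ‖ξ n‖])
    (hη.add hξ)

/-- The sequences in the definition of the predual may be indexed by any countably infinite
type. -/
theorem mem_predual_of_hasSum {ι : Type*} [Denumerable ι] {f : StrongDual ℂ M.Elt} {ξ η : ι → H}
    (hξ : Summable fun n => ‖ξ n‖ ^ 2) (hη : Summable fun n => ‖η n‖ ^ 2)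
    (hf : ∀ x, HasSum (fun n => ⟪η n, M.val x (ξ n)⟫_ℂ) (f x)) : f ∈ M.predual := by
  let e := (Denumerable.eqv ι).symm
  have h1 : Summable fun n => ‖ξ (e n)‖ ^ 2 := (e.summable_iff (f := fun n => ‖ξ n‖ ^ 2)).2 hξ
  have h2 : Summable fun n => ‖η (e n)‖ ^ 2 := (e.summable_iff (f := fun n => ‖η n‖ ^ 2)).2 hη
  exact ⟨fun n => ξ (e n), fun n => η (e n), h1, h2, fun x =>
    (e.hasSum_iff (f := fun n => ⟪η n, M.val x (ξ n)⟫_ℂ)).2 (hf x)⟩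

theorem vecFun_mem_predual (η ξ : H) : vecFun M η ξ ∈ M.predual := by
  have key (ζ : H) : Summable fun n : ℕ => ‖(Pi.single 0 ζ : ℕ → H) n‖ ^ 2 :=
    summable_of_ne_finset_zero (s := {0}) fun n hn => by
      simp [Pi.single_eq_of_ne (by simpa using hn)]
  refine ⟨Pi.single 0 ξ, Pi.single 0 η, key ξ, key η, fun x => ?_⟩
  convert! hasSum_single (f := fun n : ℕ =>
    ⟪(Pi.single 0 η : ℕ → H) n, M.val x ((Pi.single 0 ξ : ℕ → H) n)⟫_ℂ) 0 fun n hn => by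
      simp [Pi.single_eq_of_ne hn] using 1

theorem add_mem_predual {f g : StrongDual ℂ M.Elt} (hf : f ∈ M.predual) (hg : g ∈ M.predual) :
    f + g ∈ M.predual := by
  obtain ⟨ξ, η, hξ, hη, hf⟩ := hf
  obtain ⟨ξ', η', hξ', hη', hg⟩ := hg
  exact mem_predual_of_hasSum (ι := ℕ ⊕ ℕ) (ξ := Sum.elim ξ ξ') (η := Sum.elim η η')
    (Summable.sum _ hξ hξ') (Summable.sum _ hη hη') fun x => HasSum.sum (hf x) (hg x)

theorem smul_mem_predual {f : StrongDual ℂ M.Elt} (c : ℂ) (hf : f ∈ M.predual) :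
    c • f ∈ M.predual := by
  obtain ⟨ξ, η, hξ, hη, hf⟩ := hf
  refine ⟨fun n => c • ξ n, η, ?_, hη, fun x => ?_⟩
  · simpa only [norm_smul, mul_pow] using hξ.mul_left (‖c‖ ^ 2)
  · simpa [inner_smul_right] using (hf x).mul_left c

/-- The series representing a normal functional converges in the norm of the dual space. -/
theorem hasSum_vecFun {f : StrongDual ℂ M.Elt} {ξ η : ℕ → H}
    (hξ : Summable fun n => ‖ξ n‖ ^ 2) (hη : Summable fun n => ‖η n‖ ^ 2)
    (hf : ∀ x, HasSum (fun n => ⟪η n, M.val x (ξ n)⟫_ℂ) (f x)) :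
    HasSum (fun n => vecFun M (η n) (ξ n)) f := by
  have hs : Summable fun n => vecFun M (η n) (ξ n) :=
    Summable.of_norm_bounded (summable_norm_mul_norm hξ hη) fun n => norm_vecFun_le _ _
  have heq : ∑' n, vecFun M (η n) (ξ n) = f := by
    ext x
    exact ((ContinuousLinearMap.apply ℂ ℂ x).hasSum hs.hasSum).unique (hf x)
  exact heq ▸ hs.hasSum

/-- Duality `(M_*)^* = M`, for functionals on `M_*` that are restrictions of functionals on
`M^*`: the operator with matrix coefficients `φ (vecFun M η ξ)` commutes with the commutant
of `M`, because `vecFun M η (u ξ) = vecFun M (u† η) ξ` for `u` in it. -/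
theorem exists_eval_of_predual (φ : StrongDual ℂ (StrongDual ℂ M.Elt)) :
    ∃ y : M.Elt, ∀ f ∈ M.predual, φ f = f y := by
  let B : H →ₗ⋆[ℂ] H →ₗ[ℂ] ℂ := LinearMap.mk₂'ₛₗ (starRingEnd ℂ) (RingHom.id ℂ)
    (fun η ξ => φ (vecFun M η ξ))
    (fun a b ξ => by rw [← map_add]; congr 1; ext x; simp [vecFun_apply])
    (fun c a ξ => by rw [← map_smul]; congr 1; ext x; simp [vecFun_apply, mul_comm])
    (fun η a b => by rw [← map_add]; congr 1; ext x; simp [vecFun_apply])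
    (fun c η a => by
      rw [← map_smul]; congr 1; ext x; simp [vecFun_apply])
  have hB (η ξ) : ‖B η ξ‖ ≤ ‖φ‖ * ‖η‖ * ‖ξ‖ := by
    rw [mul_assoc]
    exact (φ.le_opNorm _).trans (by gcongr; exact norm_vecFun_le η ξ)
  let T : H →L[ℂ] H := ContinuousLinearMap.adjoint
    (InnerProductSpace.continuousLinearMapOfBilin (B.mkContinuous₂ ‖φ‖ hB))
  have hT (η ξ) : ⟪η, T ξ⟫_ℂ = φ (vecFun M η ξ) := by
    simp only [T]
    rw [ContinuousLinearMap.adjoint_inner_right,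
      InnerProductSpace.continuousLinearMapOfBilin_apply]
    rfl
  have hmem : T ∈ M := by
    refine mem_iff_commutant.2 fun u hu => ?_
    ext ξ
    refine ext_inner_left ℂ fun η => ?_
    change ⟪η, u (T ξ)⟫_ℂ = ⟪η, T (u ξ)⟫_ℂ
    rw [← ContinuousLinearMap.adjoint_inner_left, hT, hT]
    congr 1
    ext x
    rw [vecFun_apply, vecFun_apply, ContinuousLinearMap.adjoint_inner_left]
    exact congrArg (fun v => ⟪η, v ξ⟫_ℂ) (mem_commutant_iff.1 hu _ (val_mem x)).symm
  refine ⟨elt T hmem, ?_⟩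
  rintro f ⟨ξ, η, hξ, hη, hf⟩
  refine (φ.hasSum (hasSum_vecFun hξ hη hf)).unique ?_
  simpa only [Function.comp_def, hT, val_mk] using hf (elt T hmem)

end Predual

/-! ### Slices by normal functionals -/

section Slice

variable {H : Type*} [NormedAddCommGroup H] [InnerProductSpace ℂ H] [CompleteSpace H]
  {K : Type*} [NormedAddCommGroup K] [InnerProductSpace ℂ K] [CompleteSpace K]
  {M : VonNeumannAlgebra H} {N : VonNeumannAlgebra K}

theorem norm_tmul {H K : Type*} [NormedAddCommGroup H] [InnerProductSpace ℂ H]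
    [NormedAddCommGroup K] [InnerProductSpace ℂ K] (h : H) (k : K) : ‖tmul h k‖ = ‖h‖ * ‖k‖ := by
  simp [tmul]

theorem prodFun_apply (ω : StrongDual ℂ M.Elt) (ν : StrongDual ℂ N.Elt) (z : (M.tensor N).Elt) :
    prodFun ω ν z = ν (slice N ω z) := rfl

/-- The double series for `ω ⊗ ν`, where `ω = ∑ ⟪η n, · (ξ n)⟫` and `ν = ∑ ⟪b m, · (a m)⟫`. It
converges absolutely, so both orders of summation are available. -/
theorem hasSum_prodFun {ω : StrongDual ℂ M.Elt} {ν : StrongDual ℂ N.Elt} {ξ η : ℕ → H}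
    {a b : ℕ → K} (hξ : Summable fun n => ‖ξ n‖ ^ 2) (hη : Summable fun n => ‖η n‖ ^ 2)
    (hω : ∀ x, HasSum (fun n => ⟪η n, M.val x (ξ n)⟫_ℂ) (ω x))
    (ha : Summable fun n => ‖a n‖ ^ 2) (hb : Summable fun n => ‖b n‖ ^ 2)
    (hν : ∀ x, HasSum (fun n => ⟪b n, N.val x (a n)⟫_ℂ) (ν x)) (z : (M.tensor N).Elt) :
    HasSum (fun p : ℕ × ℕ =>
      ⟪tmul (η p.1) (b p.2), (M.tensor N).val z (tmul (ξ p.1) (a p.2))⟫_ℂ) (prodFun ω ν z) := by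
  have hs : Summable fun p : ℕ × ℕ =>
      ⟪tmul (η p.1) (b p.2), (M.tensor N).val z (tmul (ξ p.1) (a p.2))⟫_ℂ := by
    have h1 := (summable_norm_mul_norm hξ hη).mul_of_nonneg (summable_norm_mul_norm ha hb)
      (fun _ => by positivity) (fun _ => by positivity)
    refine Summable.of_norm_bounded (h1.mul_right ‖z‖) fun p => ?_
    refine (norm_inner_val_le _ _ _).trans (le_of_eq ?_)
    rw [norm_tmul, norm_tmul]
    ring
  have h2 := (Equiv.prodComm ℕ ℕ).hasSum_iff.2 hs.hasSum
  have h3 := h2.prod_fiberwise (g := fun m => ω (sliceVecR (b m) (a m) z)) fun m => by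
    convert! hω (sliceVecR (b m) (a m) z) using 2 with n
    exact (inner_vecSliceR _ _ _ _ _).symm
  have h4 : HasSum (fun m => ω (sliceVecR (b m) (a m) z)) (prodFun ω ν z) := by
    simpa only [inner_slice, prodFun_apply] using hν (slice N ω z)
  rw [← h3.unique h4]
  exact hs.hasSum

theorem prodFun_mem_predual {ω : StrongDual ℂ M.Elt} {ν : StrongDual ℂ N.Elt}
    (hω : ω ∈ M.predual) (hν : ν ∈ N.predual) : prodFun ω ν ∈ (M.tensor N).predual := by
  obtain ⟨ξ, η, hξ, hη, hω⟩ := hω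
  obtain ⟨a, b, ha, hb, hν⟩ := hν
  refine mem_predual_of_hasSum (ι := ℕ × ℕ) (ξ := fun p => tmul (ξ p.1) (a p.2))
    (η := fun p => tmul (η p.1) (b p.2)) ?_ ?_ (hasSum_prodFun hξ hη hω ha hb hν)
  · simpa only [norm_tmul, mul_pow] using hξ.mul_of_nonneg ha (fun _ => by positivity)
      (fun _ => by positivity)
  · simpa only [norm_tmul, mul_pow] using hη.mul_of_nonneg hb (fun _ => by positivity)
      (fun _ => by positivity)

/-- A slice by a normal functional is the weak-* sum of slices by vector functionals. -/
theorem hasSum_apply_sliceVecL {ω : StrongDual ℂ M.Elt} {ξ η : ℕ → H}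
    (hξ : Summable fun n => ‖ξ n‖ ^ 2) (hη : Summable fun n => ‖η n‖ ^ 2)
    (hω : ∀ x, HasSum (fun n => ⟪η n, M.val x (ξ n)⟫_ℂ) (ω x))
    {ν : StrongDual ℂ N.Elt} (hν : ν ∈ N.predual) (z : (M.tensor N).Elt) :
    HasSum (fun n => ν (sliceVecL (η n) (ξ n) z)) (ν (slice N ω z)) := by
  obtain ⟨a, b, ha, hb, hν⟩ := hν
  refine (hasSum_prodFun hξ hη hω ha hb hν z).prod_fiberwise fun n => ?_
  convert! hν (sliceVecL (η n) (ξ n) z) using 2 with m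
  exact (inner_vecSliceL _ _ _ _ _).symm

end Slice
end VonNeumannAlgebra

/-! ### Positive functionals -/

namespace VonNeumannAlgebra

section Positive

variable {H : Type*} [NormedAddCommGroup H] [InnerProductSpace ℂ H] [CompleteSpace H]
  {K : Type*} [NormedAddCommGroup K] [InnerProductSpace ℂ K] [CompleteSpace K]
  {M : VonNeumannAlgebra H} {N : VonNeumannAlgebra K}

theorem isPositive_val_star_mul_self (b : M.Elt) : (M.val (star b * b)).IsPositive := by
  rw [map_mul, map_star]
  exact ContinuousLinearMap.isPositive_adjoint_comp_self (M.val b)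

/-- Square roots of positive operators in `M` are in `M`. -/
theorem exists_eq_star_mul_self {x : M.Elt} (hx : (M.val x).IsPositive) :
    ∃ b : M.Elt, x = star b * b := by
  let := CStarAlgebra.spectralOrder M.Elt
  have := CStarAlgebra.spectralOrderedRing M.Elt
  refine CStarAlgebra.nonneg_iff_eq_star_mul_self.1 ?_
  have hsa : IsSelfAdjoint x := M.val_injective (by rw [map_star]; exact hx.isSelfAdjoint)
  rw [StarOrderedRing.nonneg_iff_spectrum_nonneg (R := ℝ) x hsa,
    ← hsa.map_spectrum_real M.val M.val_injective]
  exact (StarOrderedRing.nonneg_iff_spectrum_nonneg (R := ℝ) (M.val x) hx.isSelfAdjoint).1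
    ((ContinuousLinearMap.nonneg_iff_isPositive _).2 hx)

theorem isPositive_val_hom (T : M.Elt →⋆ₙₐ[ℂ] N.Elt) {x : M.Elt} (hx : (M.val x).IsPositive) :
    (N.val (T x)).IsPositive := by
  obtain ⟨b, rfl⟩ := exists_eq_star_mul_self hx
  rw [map_mul, map_star]
  exact isPositive_val_star_mul_self _

theorem isPositive_val_slice {ω : StrongDual ℂ M.Elt}
    (hω : ∀ x, (M.val x).IsPositive → 0 ≤ ω x) {z : (M.tensor N).Elt}
    (hz : ((M.tensor N).val z).IsPositive) : (N.val (slice N ω z)).IsPositive := by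
  have key (k : K) : 0 ≤ ⟪k, N.val (slice N ω z) k⟫_ℂ := by
    rw [inner_slice]
    exact hω _ (hz.adjoint_conj (creR H k))
  rw [ContinuousLinearMap.isPositive_iff_complex]
  intro k
  have h1 := Complex.nonneg_iff.1 (key k)
  rw [← inner_conj_symm]
  refine ⟨Complex.ext rfl ?_, h1.1⟩
  rw [Complex.conj_im, ← h1.2, neg_zero]
  rfl

theorem re_inner_star_val (x : M.Elt) (ξ : H) :
    (⟪ξ, M.val (star x) ξ⟫_ℂ).re = (⟪ξ, M.val x ξ⟫_ℂ).re := by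
  rw [map_star, ContinuousLinearMap.star_eq_adjoint, ContinuousLinearMap.adjoint_inner_right,
    ← inner_conj_symm, Complex.conj_re]

theorem isPositive_val_iff {x : M.Elt} (hx : IsSelfAdjoint x) :
    (M.val x).IsPositive ↔ ∀ ξ, 0 ≤ (⟪ξ, M.val x ξ⟫_ℂ).re := by
  rw [ContinuousLinearMap.isPositive_def']
  refine ⟨fun h ξ => ?_, fun h => ⟨hx.map M.val, fun ξ => ?_⟩⟩
  · rw [← inner_conj_symm]
    exact h.2 ξ
  · rw [ContinuousLinearMap.reApplyInnerSelf, ← inner_conj_symm]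
    exact h ξ

theorem re_inner_self {H : Type*} [NormedAddCommGroup H] [InnerProductSpace ℂ H] (ξ : H) :
    (⟪ξ, ξ⟫_ℂ).re = ‖ξ‖ ^ 2 := by
  simp [inner_self_eq_norm_sq_to_K, ← Complex.ofReal_pow]

theorem im_apply_eq_zero {f : StrongDual ℂ M.Elt} (hf : ∀ x, (M.val x).IsPositive → 0 ≤ f x)
    {a : M.Elt} (ha : IsSelfAdjoint a) : (f a).im = 0 := by
  have hs : IsSelfAdjoint ((‖a‖ : ℂ) • (1 : M.Elt)) :=
    IsSelfAdjoint.smul (Complex.conj_ofReal _) (.one _)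
  have h1 := hf ((‖a‖ : ℂ) • 1) <| (isPositive_val_iff hs).2 fun ξ => by
    simp only [map_smul, map_one, smul_apply, one_apply_eq_self, inner_smul_right,
      Complex.re_ofReal_mul, re_inner_self]
    positivity
  have h2 := hf ((‖a‖ : ℂ) • 1 - a) <| (isPositive_val_iff (hs.sub ha)).2 fun ξ => by
    have h3 := (Complex.re_le_norm _).trans (norm_inner_val_le ξ ξ a)
    simp only [map_sub, map_smul, map_one, sub_apply, smul_apply,
      one_apply_eq_self, inner_sub_right, inner_smul_right, Complex.sub_re,
      Complex.re_ofReal_mul, re_inner_self]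
    nlinarith
  have h4 := (Complex.nonneg_iff.1 h1).2
  have h5 := (Complex.nonneg_iff.1 h2).2
  rw [map_sub, Complex.sub_im, ← h4] at h5
  linarith

/-- A lower bound for the numerical range of `x` bounds `re (f x)` from below, for every positive
functional `f`. -/
theorem mul_re_one_le_re {f : StrongDual ℂ M.Elt} (hf : ∀ x, (M.val x).IsPositive → 0 ≤ f x)
    {x : M.Elt} {c : ℝ} (hc : ∀ ξ, c * ‖ξ‖ ^ 2 ≤ (⟪ξ, M.val x ξ⟫_ℂ).re) :
    c * (f 1).re ≤ (f x).re := by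
  have hsa : IsSelfAdjoint (x + star x - ((2 * c : ℝ) : ℂ) • (1 : M.Elt)) :=
    (IsSelfAdjoint.add_star_self x).sub (IsSelfAdjoint.smul (Complex.conj_ofReal _) (.one _))
  have h1 := hf _ <| (isPositive_val_iff hsa).2 fun ξ => by
    simp only [map_sub, map_add, map_smul, map_one, sub_apply, add_apply,
      smul_apply, one_apply_eq_self, inner_sub_right, inner_add_right, inner_smul_right,
      Complex.sub_re, Complex.add_re, Complex.re_ofReal_mul, re_inner_self, re_inner_star_val]
    linarith [hc ξ]
  have h2 : (f (star x)).re = (f x).re := by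
    have h3 : IsSelfAdjoint (Complex.I • (x - star x)) := by
      rw [IsSelfAdjoint, star_smul, star_sub, star_star, Complex.star_def, Complex.conj_I]
      module
    have h4 := im_apply_eq_zero hf h3
    rw [map_smul, map_sub, smul_eq_mul, Complex.I_mul_im, Complex.sub_re] at h4
    linarith
  have h5 := (Complex.nonneg_iff.1 h1).1
  rw [map_sub, map_add, map_smul, smul_eq_mul, Complex.sub_re, Complex.add_re,
    Complex.re_ofReal_mul, h2] at h5
  linarith

theorem norm_le_re_one {f : StrongDual ℂ M.Elt} (hf : ∀ x, (M.val x).IsPositive → 0 ≤ f x) :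
    ‖f‖ ≤ (f 1).re := by
  have h1 : 0 ≤ (f 1).re :=
    (Complex.nonneg_iff.1 (hf 1 (by rw [map_one]; exact ContinuousLinearMap.isPositive_one))).1
  refine f.opNorm_le_bound h1 fun x => ?_
  -- After rotating `x` by a phase, `f x` is real and equal to its norm.
  obtain ⟨c, hc, hcx⟩ := Complex.exists_norm_eq_mul_self (f x)
  have h2 := mul_re_one_le_re hf (x := -(c • x)) (c := -‖x‖) fun ξ => by
    have h3 := (Complex.re_le_norm _).trans (norm_inner_val_le ξ ξ (c • x))
    rw [norm_smul, hc, one_mul] at h3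
    rw [map_neg, neg_apply, inner_neg_right, Complex.neg_re]
    nlinarith
  rw [map_neg, map_smul, smul_eq_mul, ← hcx, Complex.neg_re, Complex.ofReal_re] at h2
  linarith

theorem norm_one_le : ‖(1 : M.Elt)‖ ≤ 1 := by
  rw [← norm_val, map_one]
  exact ContinuousLinearMap.norm_id_le

theorem IsState.norm_le_one {f : StrongDual ℂ M.Elt} (hf : IsState f) : ‖f‖ ≤ 1 := by
  simpa [hf.2] using norm_le_re_one hf.1

theorem isState_vecFun {ξ : H} (hξ : ‖ξ‖ = 1) : IsState (vecFun M ξ ξ) := by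
  refine ⟨fun x hx => ?_, ?_⟩
  · exact hx.inner_nonneg_right ξ
  · simp [vecFun_apply, inner_self_eq_norm_sq_to_K, hξ]

end Positive

end VonNeumannAlgebra

/-! ### Means for a left action -/

namespace LeftAction

variable {H : Type*} [NormedAddCommGroup H] [InnerProductSpace ℂ H] [CompleteSpace H]
  {K : Type*} [NormedAddCommGroup K] [InnerProductSpace ℂ K] [CompleteSpace K]
  {Q : HopfVonNeumannAlgebra H} {N : VonNeumannAlgebra K} (α : LeftAction Q N)

theorem pre_apply (ω : StrongDual ℂ Q.alg.Elt) (ν : StrongDual ℂ N.Elt) (y : N.Elt) :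
    α.pre ω ν y = ν (α.act ω y) := rfl

theorem norm_act_le (ω : StrongDual ℂ Q.alg.Elt) (y : N.Elt) : ‖α.act ω y‖ ≤ ‖ω‖ * ‖y‖ := by
  refine (norm_sliceOp_le ω (α.hom y)).trans ?_
  gcongr
  exact NonUnitalStarAlgHom.norm_apply_le α.hom y

theorem act_sub_left (ω ω' : StrongDual ℂ Q.alg.Elt) (y : N.Elt) :
    α.act (ω - ω') y = α.act ω y - α.act ω' y := by
  refine N.val_injective (ContinuousLinearMap.ext fun k => ext_inner_left ℂ fun k' => ?_)
  rw [map_sub, sub_apply, inner_sub_right]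
  simp only [act, inner_slice, sub_apply]

theorem act_add (ω : StrongDual ℂ Q.alg.Elt) (x y : N.Elt) :
    α.act ω (x + y) = α.act ω x + α.act ω y := by simp [act]

theorem act_smul (ω : StrongDual ℂ Q.alg.Elt) (c : ℂ) (y : N.Elt) :
    α.act ω (c • y) = c • α.act ω y := by simp [act]

theorem pre_mem_predual {ω : StrongDual ℂ Q.alg.Elt} (hω : ω ∈ Q.alg.predual)
    {ν : StrongDual ℂ N.Elt} (hν : ν ∈ N.predual) : α.pre ω ν ∈ N.predual :=
  α.normal _ (prodFun_mem_predual hω hν)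

theorem isPositive_val_act {ω : StrongDual ℂ Q.alg.Elt} (hω : IsState ω) {y : N.Elt}
    (hy : (N.val y).IsPositive) : (N.val (α.act ω y)).IsPositive :=
  isPositive_val_slice hω.1 (isPositive_val_hom α.hom hy)

/-- The identity `(ι ⊗ α)α = (Γ ⊗ ι)α` in terms of slices, the first leg being sliced by a normal
functional. -/
theorem slice_comul_sliceVecR {ω : StrongDual ℂ Q.alg.Elt} (hω : ω ∈ Q.alg.predual) (y : N.Elt)
    (k' k : K) : slice Q.alg ω (Q.comul (sliceVecR k' k (α.hom y))) =
      sliceVecR k' k (α.hom (α.act ω y)) := by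
  obtain ⟨ξ, η, hξ, hη, hω⟩ := hω
  refine Q.alg.val_injective (ContinuousLinearMap.ext fun h => ext_inner_left ℂ fun h' => ?_)
  have h1 := hasSum_apply_sliceVecL hξ hη hω (vecFun_mem_predual h' h)
    (Q.comul (sliceVecR k' k (α.hom y)))
  have h2 := hasSum_apply_sliceVecL hξ hη hω
    (α.normal _ (vecFun_mem_predual (tmul h' k') (tmul h k))) (α.hom y)
  have h3 : ⟪h', Q.alg.val (sliceVecR k' k (α.hom (α.act ω y))) h⟫_ℂ =
      (vecFun (Q.alg.tensor N) (tmul h' k') (tmul h k) ∘L homL α.hom)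
        (slice N ω (α.hom y)) := inner_vecSliceR _ _ _ _ _
  rw [h3]
  refine h1.unique ?_
  convert! h2 using 2 with n
  have h4 : vecFun Q.alg h' h (sliceVecL (η n) (ξ n) (Q.comul (sliceVecR k' k (α.hom y)))) =
      ⟪tmul (η n) h', (Q.alg.tensor Q.alg).val (Q.comul (sliceVecR k' k (α.hom y)))
        (tmul (ξ n) h)⟫_ℂ := inner_vecSliceL _ _ _ _ _
  have h5 := inner_ampR (((Q.alg.tensor Q.alg).val.comp Q.comul : Q.alg.Elt →⋆ₐ[ℂ] _) :
    Q.alg.Elt →⋆ₙₐ[ℂ] _) (α.hom y) (tmul (η n) h') (tmul (ξ n) h) k' k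
  have h6 := inner_ampL (((Q.alg.tensor N).val : _ →⋆ₙₐ[ℂ] _).comp α.hom) (α.hom y) (η n) (ξ n)
    (tmul h' k') (tmul h k)
  rw [← assoc_tmul, ← assoc_tmul, α.coassoc, LinearIsometryEquiv.inner_map_map] at h6
  exact h4.trans (h5.symm.trans h6)

theorem act_conv {ω : StrongDual ℂ Q.alg.Elt} (hω : ω ∈ Q.alg.predual)
    (ω' : StrongDual ℂ Q.alg.Elt) (y : N.Elt) :
    α.act (Q.conv ω ω') y = α.act ω' (α.act ω y) := by
  refine N.val_injective (ContinuousLinearMap.ext fun k => ext_inner_left ℂ fun k' => ?_)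
  rw [act, act, inner_slice, inner_slice, ← slice_comul_sliceVecR α hω]
  rfl

/-- A weak-* cluster point of asymptotically invariant normal states is an invariant mean. -/
theorem ReiterFP1.leftAmenable (h : α.ReiterFP1) : α.LeftAmenable := by
  classical
  let P := {ω : StrongDual ℂ Q.alg.Elt // ω ∈ Q.alg.predual}
  have hex (i : ℕ × Finset P) : ∃ ν : StrongDual ℂ N.Elt, IsState ν ∧
      ∀ ω ∈ i.2, ‖α.pre ω ν - ω.1 1 • ν‖ < 1 / ((i.1 : ℝ) + 1) := by
    obtain ⟨ν, -, hν, hF⟩ := h (1 / ((i.1 : ℝ) + 1)) (by positivity) (i.2.image Subtype.val)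
      (by simp only [Finset.mem_image]; rintro _ ⟨ω, -, rfl⟩; exact ω.2)
    exact ⟨ν, hν, fun ω hω => hF _ (Finset.mem_image_of_mem _ hω)⟩
  choose ν hν hF using hex
  let U : Ultrafilter (ℕ × Finset P) := Ultrafilter.of atTop
  have hU : (U : Filter (ℕ × Finset P)) ≤ atTop := Ultrafilter.of_le _
  obtain ⟨m, -, hm⟩ :=
    (WeakDual.isCompact_closedBall (0 : StrongDual ℂ N.Elt) 1).ultrafilter_le_nhds
    (U.map fun i => StrongDual.toWeakDual (ν i)) (by
      rw [Filter.le_principal_iff]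
      refine Filter.mem_map.2 (Filter.univ_mem' fun i => ?_)
      simpa using! (hν i).norm_le_one)
  have hlim (y : N.Elt) : Tendsto (fun i => ν i y) U (𝓝 (m y)) :=
    ((WeakDual.eval_continuous y).tendsto m).comp hm
  refine ⟨WeakDual.toStrongDual m, ⟨fun x hx => ?_, ?_⟩, fun ω hω y => ?_⟩
  · exact ge_of_tendsto' (hlim x) fun i => (hν i).1 x hx
  · refine tendsto_nhds_unique (hlim 1) ?_
    simp only [(hν _).2]
    exact tendsto_const_nhds
  · refine tendsto_nhds_unique (hlim _) ?_
    have h1 : Tendsto (fun i : ℕ × Finset P => 1 / ((i.1 : ℝ) + 1) * ‖y‖) U (𝓝 0) := by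
      have h2 : Tendsto (fun i : ℕ × Finset P => i.1) atTop atTop := by
        rw [← prod_atTop_atTop_eq]
        exact tendsto_fst
      simpa using ((tendsto_one_div_add_atTop_nhds_zero_nat.comp (h2.mono_left hU)).mul_const ‖y‖)
    have h3 : ∀ᶠ i in (U : Filter (ℕ × Finset P)),
        ‖ν i (α.act ω y) - ω 1 * ν i y‖ ≤ 1 / ((i.1 : ℝ) + 1) * ‖y‖ := by
      filter_upwards [hU (eventually_ge_atTop ((0, {⟨ω, hω⟩}) : ℕ × Finset P))] with i hi
      refine (ContinuousLinearMap.le_opNorm (α.pre ω (ν i) - ω 1 • ν i) y).trans ?_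
      gcongr
      exact (hF i ⟨ω, hω⟩ (hi.2 (Finset.mem_singleton_self _))).le
    have h4 := (squeeze_zero_norm' h3 h1).add ((hlim y).const_mul (ω 1))
    simpa using h4

/-- The convex set of all `(α_*(ω ⊗ ν) - ω(1)ν)_ω`, `ν` a normal state, has `0` in its norm
closure: a separating functional would be given by elements of `N`, and hence would yield an
`x ∈ N` on which a left invariant mean vanishes and the real part of every vector state is bounded
below by a positive constant. -/
theorem LeftAmenable.reiterFP1 (h : α.LeftAmenable) : α.ReiterFP1 := by
  classical
  obtain ⟨m, hm, hinv⟩ := h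
  intro ε hε F hF
  by_contra! hcon
  let d (ν : StrongDual ℂ N.Elt) : F → StrongDual ℂ N.Elt :=
    fun ω => α.pre ω ν - ω.1 1 • ν
  let C : Set (F → StrongDual ℂ N.Elt) := {v | ∃ ν ∈ N.predual, IsState ν ∧ v = d ν}
  have hC : Convex ℝ C := by
    rintro _ ⟨ν, hν, hνs, rfl⟩ _ ⟨ν', hν', hνs', rfl⟩ a b ha hb hab
    have hab' : (a : ℂ) + b = 1 := by exact_mod_cast hab
    refine ⟨(a : ℂ) • ν + (b : ℂ) • ν', add_mem_predual (smul_mem_predual _ hν)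
      (smul_mem_predual _ hν'), ⟨fun x hx => ?_, ?_⟩, ?_⟩
    · have h1 := hνs.1 x hx
      have h2 := hνs'.1 x hx
      have h3 : (0 : ℂ) ≤ a := by exact_mod_cast ha
      have h4 : (0 : ℂ) ≤ b := by exact_mod_cast hb
      exact add_nonneg (mul_nonneg h3 h1) (mul_nonneg h4 h2)
    · simpa [hνs.2, hνs'.2] using hab'
    · ext ω y
      simp [d, pre_apply]
      ring
  have hdisj : Disjoint (Metric.ball (0 : F → StrongDual ℂ N.Elt) ε) C := by
    rw [Set.disjoint_left]
    rintro _ hball ⟨ν, hν, hνs, rfl⟩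
    obtain ⟨ω, hω, hle⟩ := hcon ν hν hνs
    rw [mem_ball_zero_iff] at hball
    exact absurd (norm_le_pi_norm (d ν) ⟨ω, hω⟩) (not_le.2 (hball.trans_le hle))
  obtain ⟨φ, c, hφ1, hφ2⟩ := RCLike.geometric_hahn_banach_open (𝕜 := ℂ)
    (convex_ball (0 : F → StrongDual ℂ N.Elt) ε) Metric.isOpen_ball hC hdisj
  have hc : 0 < c := by simpa using hφ1 0 (Metric.mem_ball_self hε)
  have hex (ω : F) := exists_eval_of_predual (M := N)
    (φ ∘L ContinuousLinearMap.single ℂ (fun _ : F => StrongDual ℂ N.Elt) ω)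
  choose y hy using hex
  let x : N.Elt := ∑ ω : F, (α.act ω (y ω) - ω.1 1 • y ω)
  have hφx {ν : StrongDual ℂ N.Elt} (hν : ν ∈ N.predual) : φ (d ν) = ν x := by
    have h1 : d ν = ∑ ω : F, Pi.single ω (d ν ω) := (Finset.univ_sum_single _).symm
    rw [h1, map_sum, map_sum]
    refine Finset.sum_congr rfl fun ω _ => ?_
    have h2 : d ν ω ∈ N.predual := by
      have h3 : d ν ω = α.pre ω ν + (-ω.1 1) • ν := by
        ext y
        simp [d, sub_eq_add_neg]
      exact h3 ▸ add_mem_predual (α.pre_mem_predual (hF ω ω.2) hν) (smul_mem_predual _ hν)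
    refine (hy ω _ h2).trans ?_
    simp [d, pre_apply]
  have hx : m x = 0 := by
    simp only [x, map_sum, map_sub, map_smul, smul_eq_mul]
    exact Finset.sum_eq_zero fun ω _ => by rw [hinv ω (hF ω ω.2), sub_self]
  have hbound (ξ : K) : c * ‖ξ‖ ^ 2 ≤ (⟪ξ, N.val x ξ⟫_ℂ).re := by
    rcases eq_or_ne ξ 0 with rfl | hξ
    · simp
    have hξ' : 0 < ‖ξ‖ := norm_pos_iff.2 hξ
    let ζ : K := ((‖ξ‖⁻¹ : ℝ) : ℂ) • ξ
    have hζ : ‖ζ‖ = 1 := by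
      simp [ζ, norm_smul, hξ'.ne']
    have h1 := hφ2 _ ⟨_, vecFun_mem_predual ζ ζ, isState_vecFun hζ, rfl⟩
    rw [hφx (vecFun_mem_predual ζ ζ), vecFun_apply] at h1
    simp only [ζ, map_smul, inner_smul_left, inner_smul_right, Complex.conj_ofReal] at h1
    change c ≤ (_ * (_ * _) : ℂ).re at h1
    rw [Complex.re_ofReal_mul, Complex.re_ofReal_mul] at h1
    field_simp at h1
    exact h1
  have := mul_re_one_le_re hm.1 hbound
  rw [hm.2, hx] at this
  simp at this
  linarith

theorem LeftAmenable.hasLUCMean (h : α.LeftAmenable) : α.HasLUCMean := by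
  obtain ⟨m, hm, hinv⟩ := h
  let m₀ : StrongDual ℂ α.LUC := m ∘L α.LUC.subtypeL
  refine ⟨m₀, ⟨fun x hx => hm.1 _ hx, le_antisymm ?_ ?_⟩, fun ω hω y => hinv ω hω y⟩
  · refine m₀.opNorm_le_bound zero_le_one fun x => ?_
    exact (m.le_opNorm _).trans (mul_le_mul_of_nonneg_right hm.norm_le_one (norm_nonneg _))
  · -- `H` is nonzero: otherwise `M ⊗ N` would vanish, and so would `N`, by injectivity of `α`.
    obtain ⟨h₀, hh₀⟩ : ∃ h₀ : H, ‖h₀‖ = 1 := by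
      rcases subsingleton_or_nontrivial H with hH | hH
      · have h0 : α.hom 1 = α.hom 0 := (Q.alg.tensor N).val_injective <| ext_tmul fun h k => by
          rw [Subsingleton.elim h 0, ← creR_apply, map_zero, map_zero, map_zero]
        have h1 := hm.2
        rw [α.injective h0, map_zero] at h1
        exact absurd h1 zero_ne_one
      · exact exists_norm_eq H zero_le_one
    have hω := isState_vecFun (M := Q.alg) hh₀
    have hωn := vecFun_mem_predual (M := Q.alg) h₀ h₀
    -- `α` need not be unital, so `1` may fail to lie in `LUC`; the mean attains its norm at the
    -- translate of `1` by a normal state.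
    let a : α.LUC := ⟨_, α.act_mem_LUC hωn 1⟩
    have h1 : m₀ a = 1 := by
      change m (α.act _ 1) = 1
      rw [hinv _ hωn, hω.2, hm.2, one_mul]
    have h2 : ‖a‖ ≤ 1 := (α.norm_act_le _ 1).trans
      (mul_le_one₀ hω.norm_le_one (norm_nonneg _) norm_one_le)
    calc (1 : ℝ) = ‖m₀ a‖ := by rw [h1, norm_one]
      _ ≤ ‖m₀‖ * ‖a‖ := m₀.le_opNorm a
      _ ≤ ‖m₀‖ := mul_le_of_le_one_right m₀.opNorm_nonneg h2

/-- If `e i` is an approximate identity of normal states, then `y ↦ M₀ ((e i ⊗ ι) (α y))` does not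
depend on `i` and is a left invariant mean on `N` extending the mean `M₀` on `LUC`. -/
theorem HasLUCMean.leftAmenable (hQ : Q.HasStateApproxIdentity) (h : α.HasLUCMean) :
    α.LeftAmenable := by
  obtain ⟨I, _, _, _, e, he, hlim⟩ := hQ
  obtain ⟨m₀, ⟨hpos, hnorm⟩, hinv⟩ := h
  let t (ω : StrongDual ℂ Q.alg.Elt) (hω : ω ∈ Q.alg.predual) (y : N.Elt) : α.LUC :=
    ⟨α.act ω y, α.act_mem_LUC hω y⟩
  have htend {ω : StrongDual ℂ Q.alg.Elt} (hω : ω ∈ Q.alg.predual) (y : N.Elt) :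
      Tendsto (fun i => ω 1 * m₀ (t (e i) (he i).1 y)) atTop (𝓝 (m₀ (t ω hω y))) := by
    rw [tendsto_iff_norm_sub_tendsto_zero]
    have h1 := (tendsto_iff_norm_sub_tendsto_zero.1 (hlim ω hω).1).mul_const ‖y‖
    rw [zero_mul] at h1
    refine squeeze_zero (fun _ => norm_nonneg _) (fun i => ?_) h1
    rw [← hinv ω hω, ← map_sub]
    refine (m₀.le_opNorm _).trans ?_
    rw [hnorm, one_mul]
    change ‖α.act ω (α.act (e i) y) - α.act ω y‖ ≤ _
    rw [← α.act_conv (he i).1, ← act_sub_left]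
    exact α.norm_act_le _ _
  obtain ⟨i₀⟩ := ‹Nonempty I›
  have hmul {ω : StrongDual ℂ Q.alg.Elt} (hω : ω ∈ Q.alg.predual) (y : N.Elt) :
      m₀ (t ω hω y) = ω 1 * m₀ (t (e i₀) (he i₀).1 y) := by
    have h1 := htend (he i₀).1 y
    simp only [(he i₀).2.2, one_mul] at h1
    exact tendsto_nhds_unique (htend hω y) (h1.const_mul (ω 1))
  have hbd (y : N.Elt) : ‖m₀ (t (e i₀) (he i₀).1 y)‖ ≤ 1 * ‖y‖ := by
    refine (m₀.le_opNorm _).trans ?_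
    rw [hnorm, one_mul]
    exact (α.norm_act_le _ y).trans
      (mul_le_mul_of_nonneg_right (he i₀).2.norm_le_one (norm_nonneg _))
  let m : StrongDual ℂ N.Elt := LinearMap.mkContinuous
    { toFun := fun y => m₀ (t (e i₀) (he i₀).1 y)
      map_add' := fun x y => by
        rw [← map_add]; exact congrArg m₀ (Subtype.ext (α.act_add _ x y))
      map_smul' := fun c y => by
        rw [← map_smul]; exact congrArg m₀ (Subtype.ext (α.act_smul _ c y)) } 1 hbd
  have hm (y : N.Elt) : m y = m₀ (t (e i₀) (he i₀).1 y) := rfl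
  have hmpos (x : N.Elt) (hx : (N.val x).IsPositive) : 0 ≤ m x :=
    hpos _ (α.isPositive_val_act (he i₀).2 hx)
  have hext (x : α.LUC) : m x = m₀ x := by
    rw [hm, hinv _ (he i₀).1, (he i₀).2.2, one_mul]
  refine ⟨m, ⟨hmpos, ?_⟩, fun ω hω y => ?_⟩
  · have hone : (N.val 1).IsPositive := by
      rw [map_one]; exact ContinuousLinearMap.isPositive_one
    have h1 := Complex.nonneg_iff.1 (hmpos 1 hone)
    refine Complex.ext (le_antisymm ?_ ?_) h1.2.symm
    · exact (Complex.re_le_norm _).trans ((hbd 1).trans (by simpa using norm_one_le (M := N)))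
    · -- `m` extends `m₀`, so its norm is at least `1`; a positive functional has norm `m 1`.
      rw [Complex.one_re, ← hnorm]
      refine le_trans ?_ (norm_le_re_one hmpos)
      refine m₀.opNorm_le_bound (norm_nonneg _) fun x => ?_
      rw [← hext]
      exact m.le_opNorm _
  · refine Eq.trans ?_ (hmul hω y)
    refine (hinv (e i₀) (he i₀).1 (t ω hω y)).trans ?_
    rw [(he i₀).2.2, one_mul]

end LeftAction

theorem mainTheorem3 {H : Type*} [NormedAddCommGroup H] [InnerProductSpace ℂ H] [CompleteSpace H]
    {K : Type*} [NormedAddCommGroup K] [InnerProductSpace ℂ K] [CompleteSpace K]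
    (Q : HopfVonNeumannAlgebra H) (N : VonNeumannAlgebra K) (α : LeftAction Q N) :
    (α.ReiterFP1 ↔ α.LeftAmenable) ∧
    (α.LeftAmenable → α.HasLUCMean) ∧
    (Q.HasStateApproxIdentity →
      List.TFAE [α.ReiterFP1, α.LeftAmenable, α.HasLUCMean]) := by
  have h12 : α.ReiterFP1 ↔ α.LeftAmenable :=
    ⟨LeftAction.ReiterFP1.leftAmenable α, LeftAction.LeftAmenable.reiterFP1 α⟩
  refine ⟨h12, LeftAction.LeftAmenable.hasLUCMean α, fun hQ => ?_⟩
  tfae_have 1 ↔ 2 := h12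
  tfae_have 2 → 3 := LeftAction.LeftAmenable.hasLUCMean α
  tfae_have 3 → 2 := LeftAction.HasLUCMean.leftAmenable α hQ
  tfae_finish
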